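/- Let $k$ be an algebraically closed field, $n\ge 0$, and let $\mathbf q=(q_{ij})$ be any $n\times n$ matrix over $k^\times$ with $q_{ii}=1$ and $q_{ji}=q_{ij}^{-1}$ for all $i,j$. Put $\Gamma=\mathbb Z^n$ with standard basis $\epsilon_1,\dots,\epsilon_n$, put $\sigma(\alpha,\beta)=\prod_{i,j}q_{ij}^{\alpha_i\beta_j}$ for $\alpha,\beta\in\Gamma$, and let $S=\operatorname{rad}\sigma=\{\alpha\in\Gamma\mid \sigma(\alpha,\beta)=1\text{ for all }\beta\in\Gamma\}$. (1) There is a 2-cocycle $c:\Gamma\times\Gamma\to k^\times$ such that $c(\alpha,\beta)c(\beta,\alpha)^{-1}=\sigma(\alpha,\beta)$ for all $\alpha,\beta\in\Gamma$ and $c(\alpha,\beta)=1$ for all $\alpha\in S$, $\beta\in\Gamma$. (2) Let $c$ be any such cocycle. Let $A=k^c\Gamma$ be the twisted group algebra, with $k$-basis $\{x_\alpha\}_{\alpha\in\Gamma}$ and product $x_\alpha x_\beta=c(\alpha,\beta)x_{\alpha+\beta}$, and let $k\Gamma$ be the group algebra, with $k$-basis $\{y_\alpha\}_{\alpha\in\Gamma}$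 and $y_\alpha y_\beta=y_{\alpha+\beta}$. Let $\Phi_c:A\to k\Gamma$ be the $k$-linear isomorphism with $\Phi_c(x_\alpha)=y_\alpha$. Let $H=\operatorname{Hom}(\Gamma,k^\times)$ act on $A$ and on $k\Gamma$ by $k$-algebra automorphisms with $h.x_\alpha=h(\alpha)x_\alpha$ and $h.y_\alpha=h(\alpha)y_\alpha$, and hence on the sets of prime and of maximal ideals of both algebras. Let $S^\perp=\{h\in H\mid h(\alpha)=1\text{ for all }\alpha\in S\}$, and for an ideal $I$ of $k\Gamma$ put $(I:S^\perp)=\bigcap_{h\in S^\perp}h(I)$. For a ring $R$ let $\operatorname{spec}R$ be the set of prime (two-sided) ideals with the Zariski topology, and let $\operatorname{max}R$ be the set of maximal two-sided ideals with the relative topology. Then: (a) $A$ is the quantum torus $\mathcal O_{\mathbf q}((k^\times)^n)$, that is, the $k$-algebra generated by $x_1^{\pm1},\dots,x_n^{\pm1}$ subject only to the relations $x_ix_j=q_{ij}x_jx_i$: there is a $k$-algebra isomorphism $A\to\mathcal O_{\mathbf q}((k^\times)^n)$ with $x_{\epsilon_i}\mapsto x_i$ for all $i$. (b) The rule $P\mapsto\Phi_c^{-1}(P:S^\perp)$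 defines $H$-equivariant topological quotient maps $$\operatorname{spec}k\Gamma\to\operatorname{spec}A\qquad\text{and}\qquad \operatorname{max}k\Gamma\to\operatorname{max}A.$$ (c) The fibres of the second map are exactly the $S^\perp$-orbits in $\operatorname{max}k\Gamma$. -/

import Mathlib

open scoped Pointwise

noncomputable section

namespace QTorus

/-! ## Prime and maximal spectra of a noncommutative ring -/

section Spectra

variable (R : Type*) [Ring R]

/-- A prime ideal of a possibly noncommutative ring: a proper two-sided ideal `P` such that
`I J ⊆ P` implies `I ⊆ P` or `J ⊆ P`, for all two-sided ideals `I`, `J`. -/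
def IsPrimeIdeal {R : Type*} [Ring R] (P : TwoSidedIdeal R) : Prop :=
  P ≠ ⊤ ∧ ∀ I J : TwoSidedIdeal R, (∀ a ∈ I, ∀ b ∈ J, a * b ∈ P) → I ≤ P ∨ J ≤ P

/-- `spec R`: the set of prime ideals of `R`. -/
@[ext]
structure Spec where
  asIdeal : TwoSidedIdeal R
  isPrime : IsPrimeIdeal asIdeal

/-- `max R`: the set of maximal (proper two-sided) ideals of `R`. -/
@[ext]
structure MaxSpec where
  asIdeal : TwoSidedIdeal R
  isMaximal : IsCoatom asIdeal

variable {R}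

/-- `V(I)`: the set of prime ideals containing the two-sided ideal `I`. -/
def V (I : TwoSidedIdeal R) : Set (Spec R) := {P | I ≤ P.asIdeal}

/-- The Zariski topology: the closed sets are exactly the `V(I)`, `I` a two-sided ideal. -/
instance : TopologicalSpace (Spec R) :=
  TopologicalSpace.ofClosed (Set.range (V (R := R)))
    ⟨⊤, by
      ext P
      simp only [V, Set.mem_ofPred_eq, top_le_iff, Set.mem_empty_iff_false, iff_false]
      exact P.isPrime.1⟩
    (by
      intro A hA
      refine ⟨sSup {I | V I ∈ A}, ?_⟩
      ext P
      simp only [V, Set.mem_ofPred_eq, sSup_le_iff, Set.mem_sInter]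
      constructor
      · intro h s hs
        obtain ⟨I, rfl⟩ := hA hs
        exact h I hs
      · intro h I hI
        exact h _ hI)
    (by
      rintro _ ⟨I, rfl⟩ _ ⟨J, rfl⟩
      refine ⟨I ⊓ J, ?_⟩
      ext P
      simp only [V, Set.mem_ofPred_eq, Set.mem_union]
      constructor
      · intro h
        refine P.isPrime.2 I J fun a ha b hb => h ?_
        exact (TwoSidedIdeal.mem_inf R).2 ⟨I.mul_mem_right _ _ ha, J.mul_mem_left _ _ hb⟩
      · rintro (h | h)
        · exact inf_le_left.trans h
        · exact inf_le_right.trans h)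

theorem isClosed_iff (Z : Set (Spec R)) : IsClosed Z ↔ ∃ I : TwoSidedIdeal R, Z = V I := by
  rw [← isOpen_compl_iff]
  change Zᶜᶜ ∈ Set.range (V (R := R)) ↔ _
  rw [compl_compl]
  exact ⟨fun ⟨I, h⟩ => ⟨I, h.symm⟩, fun ⟨I, h⟩ => ⟨I, h.symm⟩⟩

theorem isPrimeIdeal_of_isCoatom {P : TwoSidedIdeal R} (hP : IsCoatom P) : IsPrimeIdeal P := by
  refine ⟨hP.1, fun I J h => ?_⟩
  by_contra hcon
  push Not at hcon
  have hI : P ⊔ I = ⊤ := hP.2 _ (left_lt_sup.2 hcon.1)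
  have hJ : P ⊔ J = ⊤ := hP.2 _ (left_lt_sup.2 hcon.2)
  have h1 : (1 : R) ∈ P ⊔ I := hI ▸ TwoSidedIdeal.mem_top R
  have h2 : (1 : R) ∈ P ⊔ J := hJ ▸ TwoSidedIdeal.mem_top R
  obtain ⟨p, hp, a, ha, hpa⟩ := TwoSidedIdeal.mem_sup.1 h1
  obtain ⟨p', hp', b, hb, hpb⟩ := TwoSidedIdeal.mem_sup.1 h2
  have h3 : (1 : R) ∈ P := by
    have : (1 : R) = p * (p' + b) + a * p' + a * b := by
      rw [add_assoc, ← mul_add, hpb, mul_one, mul_one, hpa]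
    rw [this]
    exact P.add_mem (P.add_mem (P.mul_mem_right _ _ hp) (P.mul_mem_left _ _ hp')) (h a ha b hb)
  exact hP.1 (top_le_iff.1 fun x _ => by simpa using P.mul_mem_left x 1 h3)

/-- The inclusion of `max R` in `spec R`. -/
def MaxSpec.toSpec (M : MaxSpec R) : Spec R :=
  ⟨M.asIdeal, isPrimeIdeal_of_isCoatom M.isMaximal⟩

/-- `max R` carries the relative topology from `spec R`. -/
instance : TopologicalSpace (MaxSpec R) :=
  TopologicalSpace.induced MaxSpec.toSpec inferInstance

end Spectra

/-! ## Group actions on spectra -/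

section Actions

variable {G : Type*} [Group G]

section Noncommutative

variable {R : Type*} [Ring R] [MulSemiringAction G R]

theorem mem_comap_smul (g : G) (I : TwoSidedIdeal R) (x : R) :
    x ∈ I.comap (MulSemiringAction.toRingHom G R g⁻¹) ↔ g⁻¹ • x ∈ I :=
  TwoSidedIdeal.mem_comap _

/-- `g • I = g(I)`, written as the preimage of `I` under the action of `g⁻¹`. -/
instance : MulAction G (TwoSidedIdeal R) where
  smul g I := I.comap (MulSemiringAction.toRingHom G R g⁻¹)
  one_smul I := by
    ext x
    refine (mem_comap_smul 1 I x).trans ?_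
    rw [inv_one, one_smul]
  mul_smul g h I := by
    ext x
    refine (mem_comap_smul (g * h) I x).trans ?_
    refine Iff.trans ?_ (mem_comap_smul g _ x).symm
    refine Iff.trans ?_ (mem_comap_smul h I _).symm
    rw [mul_inv_rev, mul_smul]

theorem mem_smul_iff {g : G} {I : TwoSidedIdeal R} {x : R} : x ∈ g • I ↔ g⁻¹ • x ∈ I :=
  mem_comap_smul g I x

theorem coe_smul (g : G) (I : TwoSidedIdeal R) :
    ((g • I : TwoSidedIdeal R) : Set R) = (fun x => g • x) '' (I : Set R) := by
  ext x
  constructor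
  · intro hx
    exact ⟨g⁻¹ • x, mem_smul_iff.1 hx, smul_inv_smul g x⟩
  · rintro ⟨y, hy, rfl⟩
    refine mem_smul_iff.2 ?_
    rwa [inv_smul_smul]

theorem smul_le_smul_of_le (g : G) {I J : TwoSidedIdeal R} (h : I ≤ J) : g • I ≤ g • J :=
  fun _ hx => mem_smul_iff.2 (h (mem_smul_iff.1 hx))

theorem smul_le_iff (g : G) {I J : TwoSidedIdeal R} : g • I ≤ J ↔ I ≤ g⁻¹ • J :=
  ⟨fun h => by simpa using smul_le_smul_of_le g⁻¹ h,
    fun h => by simpa using smul_le_smul_of_le g h⟩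

theorem smul_top_eq (g : G) : g • (⊤ : TwoSidedIdeal R) = ⊤ :=
  top_le_iff.1 fun _ _ => mem_smul_iff.2 (TwoSidedIdeal.mem_top R)

theorem smul_ne_top (g : G) {I : TwoSidedIdeal R} (h : I ≠ ⊤) : g • I ≠ ⊤ := fun h' =>
  h (by rw [← inv_smul_smul g I, h', smul_top_eq])

theorem IsPrimeIdeal.smul (g : G) {P : TwoSidedIdeal R} (hP : IsPrimeIdeal P) :
    IsPrimeIdeal (g • P) := by
  refine ⟨smul_ne_top g hP.1, fun I J h => ?_⟩
  have key := hP.2 (g⁻¹ • I) (g⁻¹ • J) (fun a ha b hb => by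
    have := h (g • a) (by simpa [mem_smul_iff] using ha) (g • b)
      (by simpa [mem_smul_iff] using hb)
    rw [← smul_mul', mem_smul_iff, inv_smul_smul] at this
    exact this)
  simpa [smul_le_iff] using key

theorem isCoatom_smul (g : G) {P : TwoSidedIdeal R} (hP : IsCoatom P) : IsCoatom (g • P) := by
  refine ⟨smul_ne_top g hP.1, fun J hJ => ?_⟩
  have hlt : P < g⁻¹ • J := by
    refine lt_of_le_of_ne ((smul_le_iff g).1 hJ.le) fun h => hJ.ne ?_
    rw [h, smul_inv_smul]
  have := hP.2 _ hlt
  rw [← smul_inv_smul g J, this, smul_top_eq]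

instance : MulAction G (Spec R) where
  smul g P := ⟨g • P.asIdeal, P.isPrime.smul g⟩
  one_smul P := Spec.ext (one_smul G P.asIdeal)
  mul_smul g h P := Spec.ext (mul_smul g h P.asIdeal)

instance : MulAction G (MaxSpec R) where
  smul g M := ⟨g • M.asIdeal, isCoatom_smul g M.isMaximal⟩
  one_smul M := MaxSpec.ext (one_smul G M.asIdeal)
  mul_smul g h M := MaxSpec.ext (mul_smul g h M.asIdeal)

end Noncommutative

section Commutative

variable {R : Type*} [CommRing R] [MulSemiringAction G R]

/-- The action `g • P = g(P)` on prime ideals of a commutative ring. -/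
instance : MulAction G (PrimeSpectrum R) where
  smul g P := ⟨g • P.asIdeal, P.isPrime.smul g⟩
  one_smul P := PrimeSpectrum.ext (one_smul G P.asIdeal)
  mul_smul g h P := PrimeSpectrum.ext (mul_smul g h P.asIdeal)

theorem isMaximal_smul (g : G) {M : Ideal R} (hM : M.IsMaximal) : (g • M).IsMaximal := by
  rw [Ideal.pointwise_smul_eq_comap]
  exact Ideal.comap_isMaximal_of_equiv _

/-- The action `g • M = g(M)` on maximal ideals of a commutative ring. -/
instance : MulAction G (MaximalSpectrum R) where
  smul g M := ⟨g • M.asIdeal, isMaximal_smul g M.isMaximal⟩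
  one_smul M := MaximalSpectrum.ext (one_smul G M.asIdeal)
  mul_smul g h M := MaximalSpectrum.ext (mul_smul g h M.asIdeal)

/-- `(I : K) = ⋂_{g ∈ K} g(I)`, the largest `K`-stable ideal contained in `I`. -/
def core (K : Subgroup G) (I : Ideal R) : Ideal R := ⨅ g ∈ K, g • I

end Commutative

end Actions

/-! ## Twisted group algebras -/

/-- A 2-cocycle on the additive group `Γ` with values in `kˣ` (trivial action). -/
structure TwoCocycle (k Γ : Type*) [Field k] [AddCommGroup Γ] where
  toFun : Γ → Γ → kˣ
  cocycle : ∀ α β γ, toFun α β * toFun (α + β) γ = toFun β γ * toFun α (β + γ)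

instance {k Γ : Type*} [Field k] [AddCommGroup Γ] :
    CoeFun (TwoCocycle k Γ) (fun _ => Γ → Γ → kˣ) := ⟨TwoCocycle.toFun⟩

section Twisted

variable {k Γ : Type*} [Field k] [AddCommGroup Γ]

/-- The twisted group algebra `k^c Γ`; as a vector space, the finitely supported
functions `Γ → k`. -/
def TwistedGroupAlgebra (_c : TwoCocycle k Γ) : Type _ := Γ →₀ k

namespace TwistedGroupAlgebra

variable (c : TwoCocycle k Γ)

instance : AddCommGroup (TwistedGroupAlgebra c) := inferInstanceAs (AddCommGroup (Γ →₀ k))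

instance : Module k (TwistedGroupAlgebra c) := inferInstanceAs (Module k (Γ →₀ k))

/-- The scalar multiple `a x_α` of the basis element `x_α`. -/
def mono (α : Γ) (a : k) : TwistedGroupAlgebra c := Finsupp.single α a

/-- The basis element `x_α`. -/
def x (α : Γ) : TwistedGroupAlgebra c := mono c α 1

/-- The bilinear product with `x_α x_β = c(α,β) x_{α+β}`. -/
def mulRaw : (Γ →₀ k) →ₗ[k] (Γ →₀ k) →ₗ[k] (Γ →₀ k) :=
  Finsupp.lsum k fun α => LinearMap.toSpanSingleton k ((Γ →₀ k) →ₗ[k] (Γ →₀ k))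
    (Finsupp.lsum k fun β => LinearMap.toSpanSingleton k (Γ →₀ k)
      (Finsupp.single (α + β) (c α β : k)))

theorem mulRaw_single (α β : Γ) (a b : k) :
    mulRaw c (Finsupp.single α a) (Finsupp.single β b)
      = Finsupp.single (α + β) (a * b * c α β) := by
  rw [mulRaw, Finsupp.lsum_single, LinearMap.toSpanSingleton_apply, LinearMap.smul_apply,
    Finsupp.lsum_single, LinearMap.toSpanSingleton_apply, Finsupp.smul_single',
    Finsupp.smul_single', mul_assoc]

/-- The product of `k^c Γ`, as a bilinear map. -/
def mulₗ : TwistedGroupAlgebra c →ₗ[k] TwistedGroupAlgebra c →ₗ[k] TwistedGroupAlgebra c :=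
  mulRaw c

instance : Mul (TwistedGroupAlgebra c) := ⟨fun f g => mulₗ c f g⟩

/-- The identity element is `c(0,0)⁻¹ x_0` (and `x_0` for a normalized cocycle). -/
instance : One (TwistedGroupAlgebra c) := ⟨mono c 0 ((c 0 0)⁻¹ : kˣ)⟩

variable {c}

theorem mono_add (α : Γ) (a b : k) : mono c α (a + b) = mono c α a + mono c α b :=
  Finsupp.single_add α a b

theorem smul_mono (r : k) (α : Γ) (a : k) : r • mono c α a = mono c α (r * a) :=
  Finsupp.smul_single' r α a

theorem mono_mul_mono (α β : Γ) (a b : k) :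
    mono c α a * mono c β b = mono c (α + β) (a * b * c α β) :=
  mulRaw_single c α β a b

theorem x_mul_x (α β : Γ) : x c α * x c β = ((c α β : kˣ) : k) • x c (α + β) := by
  simp [x, mono_mul_mono, smul_mono]

theorem induction {p : TwistedGroupAlgebra c → Prop} (f : TwistedGroupAlgebra c) (h0 : p 0)
    (hadd : ∀ f g, p f → p g → p (f + g)) (hmono : ∀ α a, p (mono c α a)) : p f :=
  Finsupp.induction_linear f h0 hadd hmono

theorem mul_add_aux (f g h : TwistedGroupAlgebra c) : f * (g + h) = f * g + f * h :=
  map_add (mulₗ c f) g h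

theorem add_mul_aux (f g h : TwistedGroupAlgebra c) : (f + g) * h = f * h + g * h :=
  LinearMap.map_add₂ (mulₗ c) f g h

theorem zero_mul_aux (f : TwistedGroupAlgebra c) : 0 * f = 0 := LinearMap.map_zero₂ (mulₗ c) f

theorem mul_zero_aux (f : TwistedGroupAlgebra c) : f * 0 = 0 := map_zero (mulₗ c f)

theorem cocycle_zero_left (c : TwoCocycle k Γ) (α : Γ) : c 0 α = c 0 0 := by
  have h := c.cocycle 0 0 α
  simp only [add_zero, zero_add] at h
  exact (mul_right_cancel h).symm

theorem cocycle_zero_right (c : TwoCocycle k Γ) (α : Γ) : c α 0 = c 0 0 := by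
  have h := c.cocycle α 0 0
  simp only [add_zero] at h
  exact mul_right_cancel h

variable (c) in
instance : Ring (TwistedGroupAlgebra c) where
  __ := (inferInstance : AddCommGroup (TwistedGroupAlgebra c))
  left_distrib := mul_add_aux
  right_distrib := add_mul_aux
  zero_mul := zero_mul_aux
  mul_zero := mul_zero_aux
  mul_assoc f g h := by
    refine induction (p := fun f => f * g * h = f * (g * h)) f (by simp only [zero_mul_aux])
      (fun _ _ h1 h2 => by simp only [add_mul_aux, h1, h2]) fun α a => ?_
    refine induction (p := fun g => mono c α a * g * h = mono c α a * (g * h)) g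
      (by simp only [zero_mul_aux, mul_zero_aux])
      (fun _ _ h1 h2 => by simp only [add_mul_aux, mul_add_aux, h1, h2]) fun β b => ?_
    refine induction (p := fun h => mono c α a * mono c β b * h
      = mono c α a * (mono c β b * h)) h (by simp only [mul_zero_aux])
      (fun _ _ h1 h2 => by simp only [mul_add_aux, h1, h2]) fun γ d => ?_
    simp only [mono_mul_mono, add_assoc]
    congr 1
    have := congrArg (Units.val) (c.cocycle α β γ)
    simp only [Units.val_mul] at this
    linear_combination a * b * d * this
  one_mul f := by
    change mono c 0 _ * f = f
    refine induction (p := fun f => mono c 0 _ * f = f) f (mul_zero_aux _) (fun _ _ h1 h2 => by rw [mul_add_aux, h1, h2])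
      fun α a => ?_
    rw [mono_mul_mono, zero_add, cocycle_zero_left c α, mul_right_comm, Units.inv_mul, one_mul]
  mul_one f := by
    change f * mono c 0 _ = f
    refine induction (p := fun f => f * mono c 0 _ = f) f (zero_mul_aux _) (fun _ _ h1 h2 => by rw [add_mul_aux, h1, h2])
      fun α a => ?_
    rw [mono_mul_mono, add_zero, cocycle_zero_right c α, mul_assoc, Units.inv_mul, mul_one]

variable (c) in
instance : Algebra k (TwistedGroupAlgebra c) :=
  Algebra.ofModule (fun r f g => LinearMap.map_smul₂ (mulₗ c) r f g)
    (fun r f g => map_smul (mulₗ c f) r g)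

end TwistedGroupAlgebra

/-! ## The torus `H = Hom(Γ, kˣ)` and its actions -/

/-- `f = ∑ f_α · α ↦ ∑ h(α) f_α · α`. -/
def scale (h : AddChar Γ kˣ) : (Γ →₀ k) →ₗ[k] (Γ →₀ k) where
  toFun f := Finsupp.onFinset f.support (fun α => (h α : k) * f α) (fun α hα => by
    rw [Finsupp.mem_support_iff]
    exact right_ne_zero_of_mul hα)
  map_add' f g := by
    ext α
    simp [mul_add]
  map_smul' r f := by
    ext α
    simp [mul_left_comm]

theorem scale_apply (h : AddChar Γ kˣ) (f : Γ →₀ k) (α : Γ) :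
    scale h f α = (h α : k) * f α := rfl

theorem scale_single (h : AddChar Γ kˣ) (α : Γ) (a : k) :
    scale h (Finsupp.single α a) = Finsupp.single α ((h α : k) * a) := by
  classical
  ext β
  rw [scale_apply, Finsupp.single_apply, Finsupp.single_apply]
  split_ifs with hαβ
  · rw [hαβ]
  · rw [mul_zero]

theorem scale_one (f : Γ →₀ k) : scale (1 : AddChar Γ kˣ) f = f := by
  ext α
  simp [scale_apply]

theorem scale_mul (h h' : AddChar Γ kˣ) (f : Γ →₀ k) :
    scale (h * h') f = scale h (scale h' f) := by
  ext α
  simp [scale_apply, mul_assoc]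

/-- `H` acts on `k^c Γ` by algebra automorphisms with `h • x_α = h(α) x_α`. -/
instance (c : TwoCocycle k Γ) : MulSemiringAction (AddChar Γ kˣ) (TwistedGroupAlgebra c) where
  smul h f := (scale h f : Γ →₀ k)
  one_smul f := scale_one f
  mul_smul h h' f := scale_mul h h' f
  smul_zero h := map_zero (scale h)
  smul_add h f g := map_add (scale h) f g
  smul_one h := by
    change scale h (Finsupp.single 0 _) = Finsupp.single 0 _
    rw [scale_single, AddChar.map_zero_eq_one, Units.val_one, one_mul]
  smul_mul h f g := by
    let s : TwistedGroupAlgebra c →ₗ[k] TwistedGroupAlgebra c := scale h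
    have hs : ∀ α a, s (TwistedGroupAlgebra.mono c α a)
        = TwistedGroupAlgebra.mono c α ((h α : k) * a) := scale_single h
    change s (f * g) = s f * s g
    refine TwistedGroupAlgebra.induction (p := fun f => s (f * g) = s f * s g) f (by simp)
      (fun _ _ h1 h2 => by simp only [add_mul, map_add, h1, h2]) fun α a => ?_
    refine TwistedGroupAlgebra.induction (p := fun g => s (_ * g) = s _ * s g) g (by simp)
      (fun _ _ h1 h2 => by simp only [mul_add, map_add, h1, h2]) fun β b => ?_
    simp only [TwistedGroupAlgebra.mono_mul_mono, hs, AddChar.map_add_eq_mul, Units.val_mul]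
    congr 1
    ring

theorem smul_x (c : TwoCocycle k Γ) (h : AddChar Γ kˣ) (α : Γ) :
    h • TwistedGroupAlgebra.x c α = (h α : k) • TwistedGroupAlgebra.x c α := by
  change scale h (Finsupp.single α 1) = (h α : k) • (Finsupp.single α 1 : Γ →₀ k)
  rw [scale_single, Finsupp.smul_single']

/-- `H` acts on `kΓ` by algebra automorphisms with `h • y_α = h(α) y_α`. -/
instance : MulSemiringAction (AddChar Γ kˣ) (AddMonoidAlgebra k Γ) where
  smul h f := .ofCoeff (scale h f.coeff)
  one_smul f := congrArg AddMonoidAlgebra.ofCoeff (scale_one f.coeff)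
  mul_smul h h' f := congrArg AddMonoidAlgebra.ofCoeff (scale_mul h h' f.coeff)
  smul_zero h := congrArg AddMonoidAlgebra.ofCoeff (map_zero (scale h))
  smul_add h f g := congrArg AddMonoidAlgebra.ofCoeff (map_add (scale h) f.coeff g.coeff)
  smul_one h := by
    change AddMonoidAlgebra.ofCoeff (scale h (Finsupp.single 0 1)) = _
    rw [scale_single, AddChar.map_zero_eq_one, Units.val_one, one_mul]
    rfl
  smul_mul h f g := by
    let s : AddMonoidAlgebra k Γ →+ AddMonoidAlgebra k Γ :=
      { toFun := fun f => .ofCoeff (scale h f.coeff)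
        map_zero' := congrArg AddMonoidAlgebra.ofCoeff (map_zero (scale h))
        map_add' := fun f g =>
          congrArg AddMonoidAlgebra.ofCoeff (map_add (scale h) f.coeff g.coeff) }
    have hs : ∀ α a, s (AddMonoidAlgebra.single α a)
        = AddMonoidAlgebra.single α ((h α : k) * a) := fun α a =>
      congrArg AddMonoidAlgebra.ofCoeff (scale_single h α a)
    change s (f * g) = s f * s g
    induction f using AddMonoidAlgebra.induction_linear with
    | zero => simp
    | add f₁ f₂ h1 h2 => simp only [add_mul, map_add, h1, h2]
    | single α a =>
      induction g using AddMonoidAlgebra.induction_linear with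
      | zero => simp
      | add f₁ f₂ h1 h2 => simp only [mul_add, map_add, h1, h2]
      | single β b =>
        simp only [AddMonoidAlgebra.single_mul_single, hs, AddChar.map_add_eq_mul,
          Units.val_mul]
        congr 1
        ring

theorem smul_y (h : AddChar Γ kˣ) (α : Γ) :
    h • (AddMonoidAlgebra.single α 1 : AddMonoidAlgebra k Γ)
      = (h α : k) • AddMonoidAlgebra.single α 1 := by
  change AddMonoidAlgebra.ofCoeff (scale h (Finsupp.single α 1)) = _
  rw [scale_single, AddMonoidAlgebra.smul_single]
  rfl

/-- The linear isomorphism `Φ_c : k^c Γ → kΓ` with `x_α ↦ y_α`. -/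
def Phi (c : TwoCocycle k Γ) : TwistedGroupAlgebra c ≃ₗ[k] AddMonoidAlgebra k Γ where
  toFun f := .ofCoeff f
  invFun f := f.coeff
  map_add' _ _ := rfl
  map_smul' _ _ := rfl
  left_inv _ := rfl
  right_inv _ := rfl

theorem Phi_x (c : TwoCocycle k Γ) (α : Γ) :
    Phi c (TwistedGroupAlgebra.x c α) = AddMonoidAlgebra.single α 1 := rfl

/-- `S^⊥`, the subgroup of those `h ∈ H` that are trivial on `S`. -/
def perp (k : Type*) [Field k] {Γ : Type*} [AddCommGroup Γ] (S : AddSubgroup Γ) :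
    Subgroup (AddChar Γ kˣ) where
  carrier := {h | ∀ α ∈ S, h α = 1}
  mul_mem' {h h'} hh hh' α hα := by
    rw [AddChar.mul_apply, hh α hα, hh' α hα, one_mul]
  one_mem' α _ := AddChar.one_apply α
  inv_mem' {h} hh α hα := by
    rw [AddChar.inv_apply, hh (-α) (neg_mem hα)]

end Twisted

/-! ## Quantum tori -/

section Torus

variable {k : Type*} [Field k] {n : ℕ}

/-- `q_{ii} = 1` and `q_{ji} = q_{ij}⁻¹`. -/
def IsMulAntisymm (q : Matrix (Fin n) (Fin n) kˣ) : Prop :=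
  (∀ i, q i i = 1) ∧ ∀ i j, q j i = (q i j)⁻¹

/-- The defining relations of the quantum torus; `inl i` stands for `x_i` and `inr i`
for `x_i⁻¹`. -/
inductive QuantumTorusRel (q : Matrix (Fin n) (Fin n) kˣ) :
    FreeAlgebra k (Fin n ⊕ Fin n) → FreeAlgebra k (Fin n ⊕ Fin n) → Prop
  | mul_inv (i : Fin n) : QuantumTorusRel q
      (FreeAlgebra.ι k (Sum.inl i) * FreeAlgebra.ι k (Sum.inr i)) 1
  | inv_mul (i : Fin n) : QuantumTorusRel q
      (FreeAlgebra.ι k (Sum.inr i) * FreeAlgebra.ι k (Sum.inl i)) 1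
  | comm (i j : Fin n) : QuantumTorusRel q
      (FreeAlgebra.ι k (Sum.inl i) * FreeAlgebra.ι k (Sum.inl j))
      ((q i j : k) • (FreeAlgebra.ι k (Sum.inl j) * FreeAlgebra.ι k (Sum.inl i)))

/-- `O_q((kˣ)^n)`: the `k`-algebra generated by `x_1^{±1}, …, x_n^{±1}` subject only to
`x_i x_j = q_{ij} x_j x_i`. -/
abbrev QuantumTorus (q : Matrix (Fin n) (Fin n) kˣ) : Type _ := RingQuot (QuantumTorusRel q)

/-- The generator `x_i` of `O_q((kˣ)^n)`. -/
def QuantumTorus.X (q : Matrix (Fin n) (Fin n) kˣ) (i : Fin n) : QuantumTorus q :=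
  RingQuot.mkAlgHom k (QuantumTorusRel q) (FreeAlgebra.ι k (Sum.inl i))

/-- `σ(α,β) = ∏_{i,j} q_{ij}^{α_i β_j}`. -/
def sigma (q : Matrix (Fin n) (Fin n) kˣ) (α β : Fin n → ℤ) : kˣ :=
  ∏ i, ∏ j, q i j ^ (α i * β j)

/-- `S = rad(σ) = {α | σ(α,β) = 1 for all β}`. -/
def rad (q : Matrix (Fin n) (Fin n) kˣ) : AddSubgroup (Fin n → ℤ) where
  carrier := {α | ∀ β, sigma q α β = 1}
  add_mem' {α α'} h h' β := by
    have : sigma q (α + α') β = sigma q α β * sigma q α' β := by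
      simp only [sigma, Pi.add_apply, add_mul, zpow_add, Finset.prod_mul_distrib]
    rw [this, h β, h' β, one_mul]
  zero_mem' β := by simp [sigma]
  neg_mem' {α} h β := by
    have : sigma q (-α) β = (sigma q α β)⁻¹ := by
      simp only [sigma, Pi.neg_apply, neg_mul, zpow_neg, Finset.prod_inv_distrib]
    rw [this, h β, inv_one]

end Torus

end QTorus

end

/-! The cosets of `S` grade both `kΓ` and `A` by `Γ/S`. Since `c` is trivial on `S` it is inflated
from `Γ/S`, so on products of homogeneous elements `Φ_c` is multiplicative up to a nonzero scalar
(`Phi_symm_mul`). Homogeneous ideals of the two algebras therefore correspond. On the side of `A`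
every two-sided ideal is homogeneous: conjugation by `x_β` is the action of the character `σ(β,·)`,
and these characters separate the cosets of `S`. On the side of `kΓ` the homogeneous ideals are the
`S^⊥`-stable ones. As `(P : S^⊥)` is the largest stable ideal inside `P`, an adjunction results: `I
≤ Φ⁻¹(P : S^⊥)` iff `Φ(I) ≤ P` (`le_twistCore_iff`). It gives primeness and continuity.

Translation by the units `y_β` shows that a homogeneous ideal is determined by its trace on `kS`,
which is fixed by `S^⊥` and central in `A`. Hence a prime of `kΓ` that contains `Φ(Q)` and has the
same trace on `kS` lies over `Q`. For maximal ideals the Nullstellensatz turns points into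
characters of `Γ`. Equal cores mean equal restrictions to `S`, so two points of a fibre differ by an
element of `S^⊥`.

The cocycle is an upper triangular bicharacter in a basis of `Γ` adapted to `S` by Smith normal
form. For the quantum torus, ordered monomials give a homomorphism from `Γ` to units modulo scalars,
and the map to `A` fixes the scalars, so no basis theorem for the quantum torus is needed. -/

noncomputable section

namespace QTorus

/-! ### The grading by `Γ/S` and stable ideals of `kΓ`. -/

section Twisting

variable {k Γ : Type*} [Field k] [AddCommGroup Γ]

/-! ### Restriction to cosets -/

open Classical in
/-- The restriction of an element of `kΓ` to the coset `β + S`. -/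
def cosetPart (S : AddSubgroup Γ) (β : Γ) : AddMonoidAlgebra k Γ →ₗ[k] AddMonoidAlgebra k Γ where
  toFun f := .ofCoeff (f.coeff.filter fun α => α - β ∈ S)
  map_add' _ _ := congrArg AddMonoidAlgebra.ofCoeff Finsupp.filter_add
  map_smul' _ _ := congrArg AddMonoidAlgebra.ofCoeff Finsupp.filter_smul

open Classical in
theorem coeff_cosetPart_of_mem {S : AddSubgroup Γ} {α β : Γ} (h : α - β ∈ S)
    (f : AddMonoidAlgebra k Γ) : (cosetPart S β f).coeff α = f.coeff α :=
  Finsupp.filter_apply_pos _ _ h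

open Classical in
theorem coeff_cosetPart_of_notMem {S : AddSubgroup Γ} {α β : Γ} (h : α - β ∉ S)
    (f : AddMonoidAlgebra k Γ) : (cosetPart S β f).coeff α = 0 :=
  Finsupp.filter_apply_neg _ _ h

open Classical in
theorem cosetPart_single_of_mem {S : AddSubgroup Γ} {α β : Γ} (h : α - β ∈ S) (a : k) :
    cosetPart S β (AddMonoidAlgebra.single α a) = AddMonoidAlgebra.single α a :=
  congrArg AddMonoidAlgebra.ofCoeff (Finsupp.filter_single_of_pos _ h)

open Classical in
theorem cosetPart_single_of_notMem {S : AddSubgroup Γ} {α β : Γ} (h : α - β ∉ S) (a : k) :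
    cosetPart S β (AddMonoidAlgebra.single α a) = 0 :=
  congrArg AddMonoidAlgebra.ofCoeff (Finsupp.filter_single_of_neg _ h)

theorem coeff_smul_char (h : AddChar Γ kˣ) (f : AddMonoidAlgebra k Γ) (α : Γ) :
    (h • f).coeff α = (h α : k) * f.coeff α := rfl

theorem char_smul_single (h : AddChar Γ kˣ) (α : Γ) (a : k) :
    h • (AddMonoidAlgebra.single α a : AddMonoidAlgebra k Γ)
      = AddMonoidAlgebra.single α ((h α : k) * a) :=
  congrArg AddMonoidAlgebra.ofCoeff (scale_single h α a)

theorem char_eq_of_sub_mem {S : AddSubgroup Γ} {h : AddChar Γ kˣ} (hh : h ∈ perp k S) {α β : Γ}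
    (hαβ : α - β ∈ S) : h α = h β := by
  rw [← sub_add_cancel α β, AddChar.map_add_eq_mul, hh _ hαβ, one_mul]

theorem perp_smul_cosetPart {S : AddSubgroup Γ} {h : AddChar Γ kˣ} (hh : h ∈ perp k S) (β : Γ)
    (f : AddMonoidAlgebra k Γ) : h • cosetPart S β f = (h β : k) • cosetPart S β f := by
  ext α
  by_cases hα : α - β ∈ S
  · rw [coeff_smul_char, AddMonoidAlgebra.coeff_smul, Finsupp.smul_apply, smul_eq_mul,
      char_eq_of_sub_mem hh hα]
  · rw [coeff_smul_char, AddMonoidAlgebra.coeff_smul, Finsupp.smul_apply,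
      coeff_cosetPart_of_notMem hα, mul_zero, smul_zero]

/-- A subgroup of `kΓ` containing all the restrictions of `f` to cosets contains `f`. -/
theorem mem_of_forall_cosetPart_mem (S : AddSubgroup Γ) (W : AddSubgroup (AddMonoidAlgebra k Γ))
    (f : AddMonoidAlgebra k Γ) (hf : ∀ β, cosetPart S β f ∈ W) : f ∈ W := by
  -- Subtracting the restriction to one coset that meets the support shrinks the support and leaves
  -- the restrictions to the other cosets unchanged.
  induction hn : f.coeff.support.card using Nat.strong_induction_on generalizing f with
  | _ n ih =>
    by_cases h0 : f = 0
    · exact h0 ▸ W.zero_mem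
    obtain ⟨β, hβ⟩ : ∃ β, f.coeff β ≠ 0 := by
      by_contra! hcon
      exact h0 (AddMonoidAlgebra.ext (Finsupp.ext hcon))
    have hββ : β - β ∈ S := by simp
    have key : f - cosetPart S β f ∈ W := by
      refine ih _ ?_ (f - cosetPart S β f) (fun γ => ?_) rfl
      · rw [← hn]
        refine Finset.card_lt_card ⟨fun α hα => ?_, fun hsub => ?_⟩
        · rw [Finsupp.mem_support_iff] at hα ⊢
          intro hfα
          apply hα
          rw [AddMonoidAlgebra.coeff_sub, Finsupp.sub_apply, hfα, zero_sub, neg_eq_zero]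
          by_cases hαβ : α - β ∈ S
          · rw [coeff_cosetPart_of_mem hαβ, hfα]
          · exact coeff_cosetPart_of_notMem hαβ f
        · have := hsub (Finsupp.mem_support_iff.2 hβ)
          rw [Finsupp.mem_support_iff, AddMonoidAlgebra.coeff_sub, Finsupp.sub_apply,
            coeff_cosetPart_of_mem hββ, sub_self] at this
          exact this rfl
      · by_cases hγ : γ - β ∈ S
        · have : cosetPart S γ (f - cosetPart S β f) = 0 := by
            ext α
            by_cases hα : α - γ ∈ S
            · have : α - β ∈ S := by simpa using S.add_mem hα hγ
              rw [coeff_cosetPart_of_mem hα, AddMonoidAlgebra.coeff_sub, Finsupp.sub_apply,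
                coeff_cosetPart_of_mem this, sub_self]
              rfl
            · rw [coeff_cosetPart_of_notMem hα]
              rfl
          rw [this]
          exact W.zero_mem
        · have : cosetPart S γ (f - cosetPart S β f) = cosetPart S γ f := by
            ext α
            by_cases hα : α - γ ∈ S
            · have : α - β ∉ S := fun h => hγ (by simpa using S.sub_mem h hα)
              rw [coeff_cosetPart_of_mem hα, coeff_cosetPart_of_mem hα,
                AddMonoidAlgebra.coeff_sub, Finsupp.sub_apply,
                coeff_cosetPart_of_notMem this, sub_zero]
            · rw [coeff_cosetPart_of_notMem hα, coeff_cosetPart_of_notMem hα]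
          rw [this]
          exact hf γ
    simpa using W.add_mem key (hf β)

/-- A subspace stable under enough characters contains the restrictions of its elements to the
cosets of `S`. -/
theorem cosetPart_mem_of_stable {S : AddSubgroup Γ} {T : Set (AddChar Γ kˣ)}
    (hT : T ⊆ perp k S) (hsep : ∀ α ∉ S, ∃ h ∈ T, h α ≠ 1)
    (W : Submodule k (AddMonoidAlgebra k Γ)) (hW : ∀ h ∈ T, ∀ f ∈ W, h • f ∈ W)
    {f : AddMonoidAlgebra k Γ} (hf : f ∈ W) (β : Γ) : cosetPart S β f ∈ W := by
  classical
  -- For `h ∈ T` with `h (γ - β) ≠ 1`, the operator `(h β - h γ)⁻¹ (h - h γ)` preserves `W`, kills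
  -- the coefficient at `γ` and is the identity on `β + S`. Applying one such operator for each
  -- support point outside the coset leaves the restriction; the last clause keeps the support from
  -- growing.
  have key : ∀ F : Finset Γ, (∀ γ ∈ F, γ - β ∉ S) → ∃ g ∈ W,
      (∀ α, α - β ∈ S → g.coeff α = f.coeff α) ∧ (∀ γ ∈ F, g.coeff γ = 0) ∧
      ∀ α, f.coeff α = 0 → g.coeff α = 0 := by
    intro F
    induction F using Finset.induction_on with
    | empty => exact fun _ => ⟨f, hf, fun _ _ => rfl, by simp, fun _ h => h⟩
    | insert γ F _ ih =>
      intro hF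
      obtain ⟨g, hg, h1, h2, h3⟩ := ih fun δ hδ => hF δ (Finset.mem_insert_of_mem hδ)
      obtain ⟨h, hhT, hne⟩ := hsep _ (hF γ (Finset.mem_insert_self _ _))
      have hne' : ((h β : kˣ) : k) - (h γ : kˣ) ≠ 0 := by
        intro h0
        apply hne
        rw [AddChar.map_sub_eq_div, div_eq_one]
        exact (Units.ext (sub_eq_zero.1 h0)).symm
      have hcoeff : ∀ α, ((((h β : kˣ) : k) - (h γ : kˣ))⁻¹ • (h • g - ((h γ : kˣ) : k) • g)).coeff α
          = (((h β : kˣ) : k) - (h γ : kˣ))⁻¹ * (((h α : kˣ) : k) * g.coeff α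
            - ((h γ : kˣ) : k) * g.coeff α) := fun α => rfl
      refine ⟨(((h β : kˣ) : k) - (h γ : kˣ))⁻¹ • (h • g - ((h γ : kˣ) : k) • g),
        W.smul_mem _ (W.sub_mem (hW h hhT g hg) (W.smul_mem _ hg)), fun α hα => ?_,
        fun δ hδ => ?_, fun α hα => ?_⟩
      · rw [hcoeff, char_eq_of_sub_mem (hT hhT) hα, h1 α hα, ← sub_mul, inv_mul_cancel_left₀ hne']
      · rw [hcoeff]
        rcases Finset.mem_insert.1 hδ with rfl | hδ
        · rw [sub_self, mul_zero]
        · rw [h2 δ hδ, mul_zero, mul_zero, sub_zero, mul_zero]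
      · rw [hcoeff, h3 α hα, mul_zero, mul_zero, sub_zero, mul_zero]
  obtain ⟨g, hg, h1, h2, h3⟩ := key (f.coeff.support.filter fun α => α - β ∉ S)
    fun γ hγ => (Finset.mem_filter.1 hγ).2
  have : cosetPart S β f = g := by
    ext α
    by_cases hα : α - β ∈ S
    · rw [coeff_cosetPart_of_mem hα, h1 α hα]
    · rw [coeff_cosetPart_of_notMem hα]
      by_cases hfα : f.coeff α = 0
      · exact (h3 α hfα).symm
      · exact (h2 α (Finset.mem_filter.2 ⟨Finsupp.mem_support_iff.2 hfα, hα⟩)).symm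
  rwa [this]

/-! ### Cocycles inflated from a quotient -/

/-- The cocycle `c` is inflated from `Γ/S`, its commutators are given by characters, and `S` is the
radical of the commutator pairing. -/
structure IsInflated (c : TwoCocycle k Γ) (S : AddSubgroup Γ) : Prop where
  one_left : ∀ α ∈ S, ∀ β, c α β = 1
  one_right : ∀ α ∈ S, ∀ β, c β α = 1
  exists_char : ∀ β, ∃ h ∈ perp k S, ∀ α, c β α = h α * c α β
  exists_ne : ∀ α ∉ S, ∃ β, c β α ≠ c α β

namespace IsInflated

variable {c : TwoCocycle k Γ} {S : AddSubgroup Γ} (hc : IsInflated c S)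

/-- The characters `α ↦ c(β,α) c(α,β)⁻¹`. -/
def commChars (c : TwoCocycle k Γ) : Set (AddChar Γ kˣ) := {h | ∃ β, ∀ α, c β α = h α * c α β}

include hc

theorem commChars_subset : commChars c ⊆ perp k S := by
  rintro h ⟨β, hβ⟩ α hα
  have := hβ α
  rwa [hc.one_left α hα, hc.one_right α hα, mul_one, eq_comm] at this

/-- With `commChars_subset`, this allows `cosetPart_mem_of_stable` to be applied to `T = commChars
c`. -/
theorem commChars_separates (α : Γ) (hα : α ∉ S) : ∃ h ∈ commChars c, h α ≠ 1 := by
  obtain ⟨β, hβ⟩ := hc.exists_ne α hα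
  obtain ⟨h, _, hh⟩ := hc.exists_char β
  refine ⟨h, ⟨β, hh⟩, fun h1 => hβ ?_⟩
  rw [hh, h1, one_mul]

/-- The cocycle identity at `(α - β, β, γ)`, in which both factors with first argument `α - β` are
trivial. -/
theorem congr_left {α β : Γ} (h : α - β ∈ S) (γ : Γ) : c α γ = c β γ := by
  have := c.cocycle (α - β) β γ
  rwa [hc.one_left _ h, hc.one_left _ h, one_mul, mul_one, sub_add_cancel] at this

theorem congr_right {α β : Γ} (h : α - β ∈ S) (γ : Γ) : c γ α = c γ β := by
  have := c.cocycle γ β (α - β)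
  rw [hc.one_right _ h, hc.one_right _ h, one_mul, mul_one, add_sub_cancel] at this
  exact this.symm

/-- By `congr_left` and `congr_right` the cocycle is constant on a pair of cosets. This comparison
of the two products underlies every transfer of ideals. -/
theorem Phi_symm_mul (α β : Γ) (f g : AddMonoidAlgebra k Γ) :
    (Phi c).symm (cosetPart S α f) * (Phi c).symm (cosetPart S β g)
      = ((c α β : kˣ) : k) • (Phi c).symm (cosetPart S α f * cosetPart S β g) := by
  induction f using AddMonoidAlgebra.induction_linear with
  | zero => simp
  | add f₁ f₂ h1 h2 => simp only [add_mul, map_add, h1, h2, smul_add]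
  | single α' a =>
    induction g using AddMonoidAlgebra.induction_linear with
    | zero => simp
    | add f₁ f₂ h1 h2 => simp only [mul_add, map_add, h1, h2, smul_add]
    | single β' b =>
      by_cases hα : α' - α ∈ S
      swap
      · simp [cosetPart_single_of_notMem hα]
      by_cases hβ : β' - β ∈ S
      swap
      · simp [cosetPart_single_of_notMem hβ]
      rw [cosetPart_single_of_mem hα, cosetPart_single_of_mem hβ,
        AddMonoidAlgebra.single_mul_single, ← hc.congr_left hα, ← hc.congr_right hβ]
      change TwistedGroupAlgebra.mono c α' a * TwistedGroupAlgebra.mono c β' b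
        = ((c α' β' : kˣ) : k) • TwistedGroupAlgebra.mono c (α' + β') (a * b)
      rw [TwistedGroupAlgebra.mono_mul_mono, TwistedGroupAlgebra.smul_mono, mul_comm]

end IsInflated

/-! ### Stable and homogeneous ideals -/

/-- Stability under `S^⊥`. -/
def IsStable (S : AddSubgroup Γ) (J : Ideal (AddMonoidAlgebra k Γ)) : Prop :=
  ∀ h ∈ perp k S, ∀ f ∈ J, h • f ∈ J

/-- The ideal contains the restrictions of its elements to the cosets of `S`. -/
def IsHomogeneous (S : AddSubgroup Γ) (J : Ideal (AddMonoidAlgebra k Γ)) : Prop :=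
  ∀ β, ∀ f ∈ J, cosetPart S β f ∈ J

theorem smul_mem_ideal (J : Ideal (AddMonoidAlgebra k Γ)) (r : k) {f : AddMonoidAlgebra k Γ}
    (hf : f ∈ J) : r • f ∈ J :=
  (J.restrictScalars k).smul_mem r hf

theorem smul_mem_twoSidedIdeal {A : Type*} [Ring A] [Algebra k A] (I : TwoSidedIdeal A) (r : k)
    {f : A} (hf : f ∈ I) : r • f ∈ I := by
  rw [Algebra.smul_def]
  exact I.mul_mem_left _ _ hf

theorem IsHomogeneous.isStable {S : AddSubgroup Γ} {J : Ideal (AddMonoidAlgebra k Γ)}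
    (hJ : IsHomogeneous S J) : IsStable S J := fun h hh f hf =>
  mem_of_forall_cosetPart_mem S
    (J.toAddSubgroup.comap (DistribSMul.toAddMonoidHom (AddMonoidAlgebra k Γ) h)) f fun β => by
      change h • cosetPart S β f ∈ J
      rw [perp_smul_cosetPart hh]
      exact smul_mem_ideal J _ (hJ β f hf)

/-- The commutator characters lie in `S^⊥` and already separate the cosets of `S`, so no extension
of characters is needed. -/
theorem IsStable.isHomogeneous {c : TwoCocycle k Γ} {S : AddSubgroup Γ} (hc : IsInflated c S)
    {J : Ideal (AddMonoidAlgebra k Γ)} (hJ : IsStable S J) : IsHomogeneous S J := fun β _ hf =>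
  cosetPart_mem_of_stable hc.commChars_subset hc.commChars_separates (J.restrictScalars k)
    (fun h hh f hf => hJ h (hc.commChars_subset hh) f hf) hf β

theorem cosetPart_zero_single_mul {S : AddSubgroup Γ} (β : Γ) (f : AddMonoidAlgebra k Γ) :
    cosetPart S 0 (AddMonoidAlgebra.single (-β) 1 * f)
      = AddMonoidAlgebra.single (-β) 1 * cosetPart S β f := by
  induction f using AddMonoidAlgebra.induction_linear with
  | zero => simp
  | add f₁ f₂ h1 h2 => simp only [mul_add, map_add, h1, h2]
  | single α a =>
    by_cases h : α - β ∈ S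
    · rw [cosetPart_single_of_mem h, AddMonoidAlgebra.single_mul_single,
        cosetPart_single_of_mem (by rwa [sub_zero, neg_add_eq_sub])]
    · rw [cosetPart_single_of_notMem h, AddMonoidAlgebra.single_mul_single,
        cosetPart_single_of_notMem (by rwa [sub_zero, neg_add_eq_sub]), mul_zero]

/-- Here and below, `cosetPart S 0 f = f` expresses that `f` lies in `kS`. -/
theorem cosetPart_zero_mul {S : AddSubgroup Γ} {f g : AddMonoidAlgebra k Γ}
    (hf : cosetPart S 0 f = f) (hg : cosetPart S 0 g = g) : cosetPart S 0 (f * g) = f * g := by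
  suffices h : ∀ f g : AddMonoidAlgebra k Γ, cosetPart S 0 (cosetPart S 0 f * cosetPart S 0 g)
      = cosetPart S 0 f * cosetPart S 0 g by simpa only [hf, hg] using h f g
  intro f g
  induction f using AddMonoidAlgebra.induction_linear with
  | zero => simp
  | add f₁ f₂ h1 h2 => simp only [add_mul, map_add, h1, h2]
  | single α a =>
    induction g using AddMonoidAlgebra.induction_linear with
    | zero => simp
    | add f₁ f₂ h1 h2 => simp only [mul_add, map_add, h1, h2]
    | single β b =>
      by_cases hα : α - 0 ∈ S
      swap
      · simp [cosetPart_single_of_notMem hα]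
      by_cases hβ : β - 0 ∈ S
      swap
      · simp [cosetPart_single_of_notMem hβ]
      rw [cosetPart_single_of_mem hα, cosetPart_single_of_mem hβ,
        AddMonoidAlgebra.single_mul_single, cosetPart_single_of_mem]
      simpa using S.add_mem hα hβ

/-- Homogeneous ideals are determined by their intersections with `kS`. -/
theorem IsHomogeneous.le_of_forall {S : AddSubgroup Γ} {J J' : Ideal (AddMonoidAlgebra k Γ)}
    (hJ : IsHomogeneous S J) (h : ∀ f ∈ J, cosetPart S 0 f = f → f ∈ J') : J ≤ J' := fun f hf =>
  mem_of_forall_cosetPart_mem S J'.toAddSubgroup f fun β => by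
    -- The unit `y_{-β}` moves the component in `β + S` into `kS`, where `h` applies; `y_β` then
    -- moves it back.
    have h1 := h _ (hJ 0 _ (J.mul_mem_left (AddMonoidAlgebra.single (-β) 1) hf)) (by
      ext α
      by_cases hα : α - 0 ∈ S
      · rw [coeff_cosetPart_of_mem hα]
      · rw [coeff_cosetPart_of_notMem hα, coeff_cosetPart_of_notMem hα])
    rw [cosetPart_zero_single_mul] at h1
    have h2 := J'.mul_mem_left (AddMonoidAlgebra.single β 1) h1
    rwa [← mul_assoc, AddMonoidAlgebra.single_mul_single, add_neg_cancel, one_mul,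
      ← AddMonoidAlgebra.one_def, one_mul] at h2

theorem perp_smul_of_cosetPart_eq {S : AddSubgroup Γ} {h : AddChar Γ kˣ} (hh : h ∈ perp k S)
    {f : AddMonoidAlgebra k Γ} (hf : cosetPart S 0 f = f) : h • f = f := by
  rw [← hf, perp_smul_cosetPart hh, AddChar.map_zero_eq_one, Units.val_one, one_smul]

/-! ### The core -/

theorem mem_core {G R : Type*} [Group G] [CommRing R] [MulSemiringAction G R] {K : Subgroup G}
    {I : Ideal R} {f : R} : f ∈ core K I ↔ ∀ g ∈ K, g • f ∈ I := by
  simp only [core, Ideal.mem_iInf, Ideal.mem_pointwise_smul_iff_inv_smul_mem]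
  exact ⟨fun h g hg => by simpa using h g⁻¹ (inv_mem hg), fun h g hg => h g⁻¹ (inv_mem hg)⟩

theorem core_le {G R : Type*} [Group G] [CommRing R] [MulSemiringAction G R] (K : Subgroup G)
    (I : Ideal R) : core K I ≤ I := fun f hf => by
  simpa using mem_core.1 hf 1 (one_mem K)

theorem isStable_core (S : AddSubgroup Γ) (I : Ideal (AddMonoidAlgebra k Γ)) :
    IsStable S (core (perp k S) I) := fun h hh f hf => mem_core.2 fun g hg => by
  rw [← mul_smul]
  exact mem_core.1 hf _ (mul_mem hg hh)

theorem IsStable.le_core {S : AddSubgroup Γ} {I J : Ideal (AddMonoidAlgebra k Γ)}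
    (hJ : IsStable S J) (h : J ≤ I) : J ≤ core (perp k S) I := fun f hf =>
  mem_core.2 fun g hg => h (hJ g hg f hf)

/-- `S^⊥` fixes `kS` pointwise, so an ideal and its core have the same trace on `kS`. -/
theorem mem_core_of_cosetPart_eq {S : AddSubgroup Γ} {I : Ideal (AddMonoidAlgebra k Γ)}
    {f : AddMonoidAlgebra k Γ} (hf : f ∈ I) (hf' : cosetPart S 0 f = f) :
    f ∈ core (perp k S) I :=
  mem_core.2 fun g hg => by rwa [perp_smul_of_cosetPart_eq hg hf']

/-- Holds because `H` is abelian; this is the source of equivariance. -/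
theorem mem_core_smul {S : AddSubgroup Γ} {I : Ideal (AddMonoidAlgebra k Γ)} (h : AddChar Γ kˣ)
    {f : AddMonoidAlgebra k Γ} :
    f ∈ core (perp k S) (h • I) ↔ h⁻¹ • f ∈ core (perp k S) I := by
  simp only [mem_core, Ideal.mem_pointwise_smul_iff_inv_smul_mem, ← mul_smul, mul_comm h⁻¹]

theorem core_smul_of_mem {S : AddSubgroup Γ} (I : Ideal (AddMonoidAlgebra k Γ))
    {h : AddChar Γ kˣ} (hh : h ∈ perp k S) : core (perp k S) (h • I) = core (perp k S) I := by
  ext f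
  rw [mem_core_smul]
  refine ⟨fun hf => ?_, fun hf => isStable_core S I _ (inv_mem hh) f hf⟩
  simpa using isStable_core S I h hh _ hf

end Twisting

/-! ### Ideals of `A` versus stable ideals of `kΓ`, and prime spectra. -/

section Spectra

variable {k Γ : Type*} [Field k] [AddCommGroup Γ]

/-! ### The correspondence of ideals -/

namespace TwistedGroupAlgebra

theorem x_mul_eq_char_smul_mul (c : TwoCocycle k Γ) {β : Γ} {h : AddChar Γ kˣ}
    (hh : ∀ α, c β α = h α * c α β) (f : TwistedGroupAlgebra c) :
    x c β * f = (h • f) * x c β := by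
  have h0 : h • (0 : TwistedGroupAlgebra c) = 0 := map_zero (scale h)
  have hadd : ∀ f g : TwistedGroupAlgebra c, h • (f + g) = h • f + h • g := map_add (scale h)
  refine induction (p := fun f => x c β * f = (h • f) * x c β) f (by rw [h0, mul_zero, zero_mul])
    (fun _ _ h1 h2 => by rw [mul_add, hadd, add_mul, h1, h2]) fun α a => ?_
  have hs : h • mono c α a = mono c α ((h α : k) * a) := scale_single h α a
  rw [hs, x, mono_mul_mono, mono_mul_mono, hh, add_comm]
  congr 1
  push_cast
  ring

/-- The factor `c 0 0` appears because the identity is `c(0,0)⁻¹ x_0`; no normalization is assumed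
here. -/
theorem x_mul_x_neg (c : TwoCocycle k Γ) (β : Γ) :
    x c β * x c (-β) = (((c β (-β) * c 0 0 : kˣ)) : k) • (1 : TwistedGroupAlgebra c) := by
  rw [x_mul_x, add_neg_cancel]
  change _ = _ • mono c 0 _
  rw [x, smul_mono, smul_mono]
  simp

end TwistedGroupAlgebra

/-- `x_β f x_{-β}` is a nonzero scalar multiple of `h • f`. -/
theorem char_smul_mem_of_commChars {c : TwoCocycle k Γ} (I : TwoSidedIdeal (TwistedGroupAlgebra c))
    {h : AddChar Γ kˣ} (hh : h ∈ IsInflated.commChars c) {f : TwistedGroupAlgebra c} (hf : f ∈ I) :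
    h • f ∈ I := by
  obtain ⟨β, hβ⟩ := hh
  have h1 := I.mul_mem_right _ (TwistedGroupAlgebra.x c (-β))
    (I.mul_mem_left (TwistedGroupAlgebra.x c β) f hf)
  rw [TwistedGroupAlgebra.x_mul_eq_char_smul_mul c hβ, mul_assoc,
    TwistedGroupAlgebra.x_mul_x_neg, mul_smul_comm, mul_one] at h1
  have h2 := smul_mem_twoSidedIdeal I (((c β (-β) * c 0 0)⁻¹ : kˣ) : k) h1
  rwa [smul_smul, Units.inv_mul, one_smul] at h2

/-- A two-sided ideal of `k^c Γ` as a subspace of `kΓ`. -/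
def submoduleOfIdeal {c : TwoCocycle k Γ} (I : TwoSidedIdeal (TwistedGroupAlgebra c)) :
    Submodule k (AddMonoidAlgebra k Γ) where
  carrier := {f | (Phi c).symm f ∈ I}
  add_mem' hf hg := by
    change _ ∈ I
    rw [map_add]
    exact I.add_mem hf hg
  zero_mem' := by
    change _ ∈ I
    rw [map_zero]
    exact I.zero_mem
  smul_mem' r f hf := by
    change _ ∈ I
    rw [map_smul]
    exact smul_mem_twoSidedIdeal I r hf

namespace IsInflated

variable {c : TwoCocycle k Γ} {S : AddSubgroup Γ} (hc : IsInflated c S)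

-- Two-sided ideals of `A` are automatically homogeneous, being stable under the commutator
-- characters.
include hc in
theorem cosetPart_mem_submoduleOfIdeal (I : TwoSidedIdeal (TwistedGroupAlgebra c))
    {f : AddMonoidAlgebra k Γ} (hf : f ∈ submoduleOfIdeal I) (β : Γ) :
    cosetPart S β f ∈ submoduleOfIdeal I :=
  cosetPart_mem_of_stable hc.commChars_subset hc.commChars_separates _
    (fun _ hh _ hf => char_smul_mem_of_commChars I hh hf) hf β

/-- The ideal `Φ(I)` of `kΓ`, for a two-sided ideal `I` of `k^c Γ`. -/
def untwist (I : TwoSidedIdeal (TwistedGroupAlgebra c)) : Ideal (AddMonoidAlgebra k Γ) where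
  carrier := submoduleOfIdeal I
  add_mem' := add_mem
  zero_mem' := zero_mem _
  smul_mem' g f hf := by
    -- Both factors are reduced to single cosets, where the two products differ by the unit `c α β`.
    refine mem_of_forall_cosetPart_mem S
      ((submoduleOfIdeal I).toAddSubgroup.comap (AddMonoidHom.mulLeft g)) f fun β => ?_
    refine mem_of_forall_cosetPart_mem S ((submoduleOfIdeal I).toAddSubgroup.comap
      (AddMonoidHom.mulRight (cosetPart S β f))) g fun α => ?_
    change cosetPart S α g * cosetPart S β f ∈ submoduleOfIdeal I
    have h1 := I.mul_mem_left ((Phi c).symm (cosetPart S α g)) _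
      (hc.cosetPart_mem_submoduleOfIdeal I hf β)
    rw [hc.Phi_symm_mul] at h1
    have h2 := smul_mem_twoSidedIdeal I (((c α β)⁻¹ : kˣ) : k) h1
    rwa [smul_smul, Units.inv_mul, one_smul] at h2

theorem mem_untwist {I : TwoSidedIdeal (TwistedGroupAlgebra c)} {f : AddMonoidAlgebra k Γ} :
    f ∈ hc.untwist I ↔ (Phi c).symm f ∈ I := Iff.rfl

theorem isHomogeneous_untwist (I : TwoSidedIdeal (TwistedGroupAlgebra c)) :
    IsHomogeneous S (hc.untwist I) := fun β _ hf => hc.cosetPart_mem_submoduleOfIdeal I hf β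

theorem isStable_untwist (I : TwoSidedIdeal (TwistedGroupAlgebra c)) :
    IsStable S (hc.untwist I) := (hc.isHomogeneous_untwist I).isStable

include hc in
theorem Phi_symm_mul_mem {J : Ideal (AddMonoidAlgebra k Γ)} {f g : AddMonoidAlgebra k Γ}
    (h : ∀ α β, cosetPart S α f * cosetPart S β g ∈ J) :
    Phi c ((Phi c).symm f * (Phi c).symm g) ∈ J := by
  refine mem_of_forall_cosetPart_mem S (J.toAddSubgroup.comap
    ((Phi c).toLinearMap.toAddMonoidHom.comp
    ((AddMonoidHom.mulRight ((Phi c).symm g)).comp (Phi c).symm.toLinearMap.toAddMonoidHom)))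
    f fun α => ?_
  refine mem_of_forall_cosetPart_mem S (J.toAddSubgroup.comap
    ((Phi c).toLinearMap.toAddMonoidHom.comp
    ((AddMonoidHom.mulLeft ((Phi c).symm (cosetPart S α f))).comp
      (Phi c).symm.toLinearMap.toAddMonoidHom))) g fun β => ?_
  change Phi c ((Phi c).symm (cosetPart S α f) * (Phi c).symm (cosetPart S β g)) ∈ J
  rw [hc.Phi_symm_mul, map_smul, LinearEquiv.apply_symm_apply]
  exact smul_mem_ideal J _ (h α β)

/-- The two-sided ideal `Φ⁻¹(J)` of `k^c Γ`, for an `S^⊥`-stable ideal `J` of `kΓ`. -/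
def twist (J : Ideal (AddMonoidAlgebra k Γ)) (hJ : IsStable S J) :
    TwoSidedIdeal (TwistedGroupAlgebra c) :=
  .mk' (Phi c ⁻¹' J) (by simp) (fun {f g} hf hg => by
      simpa only [Set.mem_preimage, map_add] using! J.add_mem hf hg)
    (fun {f} hf => by simpa only [Set.mem_preimage, map_neg] using! J.neg_mem hf)
    (fun {f g} hg => hc.Phi_symm_mul_mem (f := Phi c f) (g := Phi c g)
      fun α β => J.mul_mem_left _ (hJ.isHomogeneous hc β _ hg))
    (fun {f g} hf => hc.Phi_symm_mul_mem (f := Phi c f) (g := Phi c g)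
      fun α β => J.mul_mem_right _ (hJ.isHomogeneous hc α _ hf))

theorem coe_twist (J : Ideal (AddMonoidAlgebra k Γ)) (hJ : IsStable S J) :
    (hc.twist J hJ : Set (TwistedGroupAlgebra c)) = Phi c ⁻¹' J :=
  TwoSidedIdeal.coe_mk' _ _ _ _ _ _

theorem mem_twist {J : Ideal (AddMonoidAlgebra k Γ)} {hJ : IsStable S J}
    {f : TwistedGroupAlgebra c} : f ∈ hc.twist J hJ ↔ Phi c f ∈ J :=
  TwoSidedIdeal.mem_mk' _ _ _ _ _ _ _

theorem untwist_le_iff {I : TwoSidedIdeal (TwistedGroupAlgebra c)}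
    {J : Ideal (AddMonoidAlgebra k Γ)} {hJ : IsStable S J} :
    hc.untwist I ≤ J ↔ I ≤ hc.twist J hJ :=
  ⟨fun h f hf => hc.mem_twist.2 (h (x := Phi c f) hf), fun h _ hf => hc.mem_twist.1 (h hf)⟩

theorem twist_le_iff {I : TwoSidedIdeal (TwistedGroupAlgebra c)}
    {J : Ideal (AddMonoidAlgebra k Γ)} {hJ : IsStable S J} :
    hc.twist J hJ ≤ I ↔ J ≤ hc.untwist I :=
  ⟨fun h f hf => h (x := (Phi c).symm f) (hc.mem_twist.2 hf), fun h _ hf => h (hc.mem_twist.1 hf)⟩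

include hc in
theorem mul_mem_iff {f g : AddMonoidAlgebra k Γ} (hf : cosetPart S 0 f = f)
    (hg : cosetPart S 0 g = g) (I : TwoSidedIdeal (TwistedGroupAlgebra c)) :
    (Phi c).symm (f * g) ∈ I ↔ (Phi c).symm f * (Phi c).symm g ∈ I := by
  have := hc.Phi_symm_mul 0 0 f g
  rw [hf, hg, hc.one_left 0 S.zero_mem, Units.val_one, one_smul] at this
  rw [this]

include hc in
theorem Phi_symm_one : (Phi c).symm 1 = 1 := by
  change TwistedGroupAlgebra.mono c 0 1 = TwistedGroupAlgebra.mono c 0 _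
  rw [hc.one_left 0 S.zero_mem, inv_one, Units.val_one]

theorem untwist_ne_top {I : TwoSidedIdeal (TwistedGroupAlgebra c)} (hI : I ≠ ⊤) :
    hc.untwist I ≠ ⊤ := fun h => hI <| top_le_iff.1 fun f _ =>
  (h ▸ Submodule.mem_top : Phi c f ∈ hc.untwist I)

theorem twist_ne_top {J : Ideal (AddMonoidAlgebra k Γ)} {hJ : IsStable S J} (h : J ≠ ⊤) :
    hc.twist J hJ ≠ ⊤ := fun h' => h <| top_le_iff.1 fun f _ => by
  have : (Phi c).symm f ∈ hc.twist J hJ := h' ▸ TwoSidedIdeal.mem_top _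
  exact hc.mem_twist.1 this

-- `kS` is central in `A`: against the coset of `β` the scalars are `c(0,β) = c(β,0) = 1`, and `kΓ`
-- is commutative.
include hc in
theorem Phi_symm_commute {f : AddMonoidAlgebra k Γ} (hf : cosetPart S 0 f = f)
    (g : TwistedGroupAlgebra c) : (Phi c).symm f * g = g * (Phi c).symm f := by
  refine mem_of_forall_cosetPart_mem S (AddMonoidHom.eqLocus
    ((AddMonoidHom.mulLeft ((Phi c).symm f)).comp (Phi c).symm.toLinearMap.toAddMonoidHom)
    ((AddMonoidHom.mulRight ((Phi c).symm f)).comp (Phi c).symm.toLinearMap.toAddMonoidHom))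
    (Phi c g) fun β => ?_
  change (Phi c).symm f * (Phi c).symm (cosetPart S β (Phi c g))
    = (Phi c).symm (cosetPart S β (Phi c g)) * (Phi c).symm f
  rw [← hf, hc.Phi_symm_mul, hc.Phi_symm_mul, hc.one_left 0 S.zero_mem, hc.one_right 0 S.zero_mem,
    mul_comm]

end IsInflated

/-- In a prime ideal, a product of central elements has a factor. -/
theorem IsPrimeIdeal.mem_or_mem_of_central {R : Type*} [Ring R] {P : TwoSidedIdeal R}
    (hP : IsPrimeIdeal P) {a b : R} (hb : ∀ r, b * r = r * b) (h : a * b ∈ P) :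
    a ∈ P ∨ b ∈ P := by
  -- Colon ideals avoid describing generated ones: `I = (P : b)` is two-sided since `b` is central,
  -- `J` is the set of `s` with `I s ⊆ P`, and `a ∈ I`, `b ∈ J`.
  let I : TwoSidedIdeal R := .mk' {r | r * b ∈ P} (by simp)
    (fun {r s} hr hs => by
      simpa only [Set.mem_ofPred_eq, add_mul] using P.add_mem hr hs)
    (fun {r} hr => by simpa only [Set.mem_ofPred_eq, neg_mul] using P.neg_mem hr)
    (fun {r s} hs => by
      simpa only [Set.mem_ofPred_eq, mul_assoc] using P.mul_mem_left r _ hs)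
    (fun {r s} hr => by
      have := P.mul_mem_right _ s hr
      rwa [mul_assoc, hb, ← mul_assoc] at this)
  have hI : ∀ r, r ∈ I ↔ r * b ∈ P := fun r => TwoSidedIdeal.mem_mk' _ _ _ _ _ _ _
  let J : TwoSidedIdeal R := .mk' {s | ∀ r ∈ I, r * s ∈ P} (by simp)
    (fun {s t} hs ht r hr => by simpa only [mul_add] using P.add_mem (hs r hr) (ht r hr))
    (fun {s} hs r hr => by simpa only [mul_neg] using P.neg_mem (hs r hr))
    (fun {s t} ht r hr => by
      simpa only [mul_assoc] using ht (r * s) (I.mul_mem_right _ _ hr))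
    (fun {s t} hs r hr => by
      simpa only [mul_assoc] using P.mul_mem_right _ t (hs r hr))
  have hJ : ∀ s, s ∈ J ↔ ∀ r ∈ I, r * s ∈ P := fun s => TwoSidedIdeal.mem_mk' _ _ _ _ _ _ _
  refine (hP.2 I J fun r hr s hs => (hJ s).1 hs r hr).imp (fun hle => hle ((hI a).2 h))
    fun hle => hle ((hJ b).2 fun r hr => (hI r).1 hr)

/-! ### The map of prime spectra -/

namespace IsInflated

variable {c : TwoCocycle k Γ} {S : AddSubgroup Γ} (hc : IsInflated c S)

/-- `Φ⁻¹(P : S^⊥)`. -/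
def twistCore (P : Ideal (AddMonoidAlgebra k Γ)) : TwoSidedIdeal (TwistedGroupAlgebra c) :=
  hc.twist (core (perp k S) P) (isStable_core S P)

theorem mem_twistCore {P : Ideal (AddMonoidAlgebra k Γ)} {f : TwistedGroupAlgebra c} :
    f ∈ hc.twistCore P ↔ Phi c f ∈ core (perp k S) P := hc.mem_twist

/-- `Φ(I)` is stable and the core is the largest stable ideal inside `P`. -/
theorem le_twistCore_iff {P : Ideal (AddMonoidAlgebra k Γ)}
    {I : TwoSidedIdeal (TwistedGroupAlgebra c)} : I ≤ hc.twistCore P ↔ hc.untwist I ≤ P := by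
  rw [twistCore, ← untwist_le_iff]
  exact ⟨fun h => h.trans (core_le _ _), (hc.isStable_untwist I).le_core⟩

theorem core_ne_top {P : Ideal (AddMonoidAlgebra k Γ)} (h : P ≠ ⊤) : core (perp k S) P ≠ ⊤ :=
  fun h' => h (top_le_iff.1 (h' ▸ core_le _ _))

/-- The adjunction reduces the claim to `Φ(I) Φ(J) ⊆ P`, which is checked on homogeneous components.
-/
theorem isPrimeIdeal_twistCore {P : Ideal (AddMonoidAlgebra k Γ)} (hP : P.IsPrime) :
    IsPrimeIdeal (hc.twistCore P) := by
  refine ⟨hc.twist_ne_top (core_ne_top hP.ne_top), fun I J h => ?_⟩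
  rw [le_twistCore_iff, le_twistCore_iff]
  refine (Ideal.IsPrime.mul_le hP).1 (Ideal.mul_le.2 fun f hf g hg => ?_)
  refine mem_of_forall_cosetPart_mem S (P.toAddSubgroup.comap (AddMonoidHom.mulRight g)) f
    fun α => ?_
  refine mem_of_forall_cosetPart_mem S (P.toAddSubgroup.comap
    (AddMonoidHom.mulLeft (cosetPart S α f))) g fun β => ?_
  change cosetPart S α f * cosetPart S β g ∈ P
  have h1 := h _ (hc.isHomogeneous_untwist I α f hf) _ (hc.isHomogeneous_untwist J β g hg)
  rw [hc.Phi_symm_mul, mem_twistCore, map_smul, LinearEquiv.apply_symm_apply] at h1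
  have h2 := smul_mem_ideal _ (((c α β)⁻¹ : kˣ) : k) (core_le _ _ h1)
  rwa [smul_smul, Units.inv_mul, one_smul] at h2

/-- The map `P ↦ Φ⁻¹(P : S^⊥)` of prime spectra. -/
def specMap (P : PrimeSpectrum (AddMonoidAlgebra k Γ)) : Spec (TwistedGroupAlgebra c) :=
  ⟨hc.twistCore P.asIdeal, hc.isPrimeIdeal_twistCore P.isPrime⟩

theorem twistCore_smul (h : AddChar Γ kˣ) (P : Ideal (AddMonoidAlgebra k Γ)) :
    hc.twistCore (h • P) = h • hc.twistCore P := by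
  ext f
  rw [mem_smul_iff, mem_twistCore, mem_twistCore, mem_core_smul]
  rfl

theorem twistCore_smul_of_mem {h : AddChar Γ kˣ} (hh : h ∈ perp k S)
    (P : Ideal (AddMonoidAlgebra k Γ)) : hc.twistCore (h • P) = hc.twistCore P := by
  simp only [twistCore, core_smul_of_mem P hh]

theorem specMap_smul (h : AddChar Γ kˣ) (P : PrimeSpectrum (AddMonoidAlgebra k Γ)) :
    hc.specMap (h • P) = h • hc.specMap P :=
  Spec.ext (hc.twistCore_smul h P.asIdeal)

theorem specMap_surjective : Function.Surjective hc.specMap := by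
  intro Q
  -- `M` is the complement of `Φ(Q)` in `kS`. It is multiplicatively closed because `Q` is prime and
  -- `kS` is central in `A`.
  let M : Submonoid (AddMonoidAlgebra k Γ) :=
    { carrier := {f | cosetPart S 0 f = f ∧ f ∉ hc.untwist Q.asIdeal}
      one_mem' := by
        refine ⟨cosetPart_single_of_mem (by simp) _, fun h => ?_⟩
        rw [mem_untwist, hc.Phi_symm_one] at h
        exact Q.isPrime.1 (top_le_iff.1 fun x _ => by simpa using Q.asIdeal.mul_mem_left x 1 h)
      mul_mem' := by
        rintro f g ⟨hf, hf'⟩ ⟨hg, hg'⟩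
        refine ⟨cosetPart_zero_mul hf hg, fun h => ?_⟩
        · rw [mem_untwist, hc.mul_mem_iff hf hg] at h
          exact (Q.isPrime.mem_or_mem_of_central (hc.Phi_symm_commute hg) h).elim hf' hg' }
  obtain ⟨P, hP, hle, hdisj⟩ := Ideal.exists_le_prime_disjoint (hc.untwist Q.asIdeal) M
    (Set.disjoint_left.2 fun f hf hfM => hfM.2 hf)
  refine ⟨⟨P, hP⟩, Spec.ext (le_antisymm ?_ (hc.le_twistCore_iff.2 hle))⟩
  -- The core is homogeneous, so it suffices to compare on `kS`, where `P` avoids `M`.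
  refine (hc.twist_le_iff (hJ := isStable_core S P)).2 (((isStable_core S P).isHomogeneous hc).le_of_forall
    fun f hf hf0 => ?_)
  by_contra hcon
  exact Set.disjoint_left.1 hdisj (core_le _ _ hf) ⟨hf0, hcon⟩

theorem isStable_sInf {X : Set (Ideal (AddMonoidAlgebra k Γ))}
    (hX : ∀ h ∈ perp k S, ∀ P ∈ X, h • P ∈ X) : IsStable S (sInf X) := fun h hh f hf => by
  rw [Submodule.mem_sInf] at hf ⊢
  intro P hP
  have := hf _ (hX h⁻¹ (inv_mem hh) P hP)
  simpa only [smul_inv_smul] using Ideal.smul_mem_pointwise_smul h f _ this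

theorem isQuotientMap_specMap : Topology.IsQuotientMap hc.specMap := by
  refine Topology.isQuotientMap_iff_isClosed.2 ⟨hc.specMap_surjective, fun Z => ⟨?_, fun hZ => ?_⟩⟩
  · rw [isClosed_iff, PrimeSpectrum.isClosed_iff_zeroLocus_ideal]
    rintro ⟨I, rfl⟩
    exact ⟨hc.untwist I, Set.ext fun P => hc.le_twistCore_iff⟩
  · obtain ⟨K, hK⟩ := (PrimeSpectrum.isClosed_iff_zeroLocus_ideal _).1 hZ
    have hmem : ∀ P, hc.specMap P ∈ Z ↔ K ≤ P.asIdeal := fun P =>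
      (Set.ext_iff.1 hK P : _)
    -- `K` itself need not be stable. The intersection of all primes over `Z` contains `K` and is
    -- stable, since the map is constant on `S^⊥`-orbits; it cuts out the same closed set.
    have hst : IsStable S (sInf {P | ∃ P' : PrimeSpectrum (AddMonoidAlgebra k Γ),
        hc.specMap P' ∈ Z ∧ P'.asIdeal = P}) := isStable_sInf (by
      rintro h hh _ ⟨P, hP, rfl⟩
      refine ⟨h • P, ?_, rfl⟩
      rwa [show hc.specMap (h • P) = hc.specMap P from
        Spec.ext (hc.twistCore_smul_of_mem hh P.asIdeal)])
    refine (isClosed_iff Z).2 ⟨hc.twist _ hst, Set.ext fun Q => ?_⟩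
    obtain ⟨P, rfl⟩ := hc.specMap_surjective Q
    refine ⟨fun h => ?_, fun h => (hmem P).2 ?_⟩
    · exact fun f hf => hc.mem_twistCore.2
        (hst.le_core (sInf_le ⟨P, h, rfl⟩) (hc.mem_twist.1 hf))
    · refine le_trans (le_sInf ?_) (((hc.twist_le_iff.1 h :)).trans fun f hf =>
        core_le _ _ (hc.mem_twistCore.1 hf))
      rintro _ ⟨P', hP', rfl⟩
      exact (hmem P').1 hP'

end IsInflated

end Spectra

/-! ### Maximal ideals as characters, and the fibres. -/

section MaximalSpectra

variable {k Γ : Type*} [Field k] [AddCommGroup Γ]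

/-! ### The map of maximal spectra -/

/-- The weak Nullstellensatz for `kΓ`. -/
theorem exists_algHom_ker_eq [IsAlgClosed k] [AddMonoid.FG Γ] (M : Ideal (AddMonoidAlgebra k Γ))
    [M.IsMaximal] : ∃ φ : AddMonoidAlgebra k Γ →ₐ[k] k, ∀ f, φ f = 0 ↔ f ∈ M := by
  let _ := Ideal.Quotient.field M
  have : Algebra.FiniteType k (AddMonoidAlgebra k Γ ⧸ M) :=
    Algebra.FiniteType.of_surjective (Ideal.Quotient.mkₐ k M) (Ideal.Quotient.mkₐ_surjective k M)
  -- Zariski's lemma: the residue field is finite over `k`, hence equal to `k`.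
  have := finite_of_finite_type_of_isJacobsonRing k (AddMonoidAlgebra k Γ ⧸ M)
  let e : k ≃ₐ[k] (AddMonoidAlgebra k Γ ⧸ M) := AlgEquiv.ofBijective (Algebra.ofId _ _)
    (IsAlgClosed.algebraMap_bijective_of_isIntegral (k := k) (K := AddMonoidAlgebra k Γ ⧸ M))
  refine ⟨e.symm.toAlgHom.comp (Ideal.Quotient.mkₐ k M), fun f => ?_⟩
  change e.symm (Ideal.Quotient.mk M f) = 0 ↔ _
  rw [map_eq_zero_iff _ e.symm.injective, Ideal.Quotient.eq_zero_iff_mem]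

/-- The character `α ↦ φ(y_α)`. -/
def charOfAlgHom (φ : AddMonoidAlgebra k Γ →ₐ[k] k) : AddChar Γ kˣ where
  toFun α := ⟨φ (.single α 1), φ (.single (-α) 1),
    by rw [← map_mul, AddMonoidAlgebra.single_mul_single, add_neg_cancel, one_mul,
      ← AddMonoidAlgebra.one_def, map_one],
    by rw [← map_mul, AddMonoidAlgebra.single_mul_single, neg_add_cancel, one_mul,
      ← AddMonoidAlgebra.one_def, map_one]⟩
  map_zero_eq_one' := Units.ext (map_one φ)
  map_add_eq_mul' α β := Units.ext (by
    change φ _ = φ _ * φ _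
    rw [← map_mul, AddMonoidAlgebra.single_mul_single, one_mul])

theorem coe_charOfAlgHom (φ : AddMonoidAlgebra k Γ →ₐ[k] k) (α : Γ) :
    (charOfAlgHom φ α : k) = φ (.single α 1) := rfl

theorem algHom_char_smul {φ ψ : AddMonoidAlgebra k Γ →ₐ[k] k} {h : AddChar Γ kˣ}
    (hh : ∀ α, charOfAlgHom φ α * h α = charOfAlgHom ψ α) (f : AddMonoidAlgebra k Γ) :
    φ (h • f) = ψ f := by
  induction f using AddMonoidAlgebra.induction_linear with
  | zero => rw [show h • (0 : AddMonoidAlgebra k Γ) = 0 from smul_zero h, map_zero, map_zero]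
  | add f₁ f₂ h1 h2 =>
    rw [show h • (f₁ + f₂) = h • f₁ + h • f₂ from smul_add h f₁ f₂, map_add, map_add, h1, h2]
  | single α a =>
    have hs : ∀ b : k, AddMonoidAlgebra.single α b = b • AddMonoidAlgebra.single α (1 : k) :=
      fun b => by rw [AddMonoidAlgebra.smul_single, smul_eq_mul, mul_one]
    rw [char_smul_single, hs, hs a, map_smul, map_smul, ← coe_charOfAlgHom, ← coe_charOfAlgHom,
      ← hh, Units.val_mul, smul_eq_mul, smul_eq_mul]
    ring

theorem cosetPart_zero_single {S : AddSubgroup Γ} {α : Γ} (h : α ∈ S) (a : k) :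
    cosetPart S 0 (AddMonoidAlgebra.single α a) = AddMonoidAlgebra.single α a :=
  cosetPart_single_of_mem (by rwa [sub_zero]) a

/-- For `α ∈ S` the element `y_α - φ(y_α)` lies in `M ∩ kS`, so `ψ` kills it. -/
theorem charOfAlgHom_eq {S : AddSubgroup Γ} {α : Γ} (hα : α ∈ S)
    {φ ψ : AddMonoidAlgebra k Γ →ₐ[k] k} {M : Ideal (AddMonoidAlgebra k Γ)}
    (hφ : ∀ f, φ f = 0 ↔ f ∈ M) (hψ : ∀ f ∈ M, cosetPart S 0 f = f → ψ f = 0) :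
    charOfAlgHom φ α = charOfAlgHom ψ α := by
  let y : AddMonoidAlgebra k Γ := AddMonoidAlgebra.single α 1
  have h0 : cosetPart S 0 (y - φ y • 1) = y - φ y • 1 := by
    rw [map_sub, map_smul, AddMonoidAlgebra.one_def, cosetPart_zero_single S.zero_mem,
      cosetPart_zero_single hα]
  have h1 : y - φ y • 1 ∈ M := (hφ _).1 (by
    rw [map_sub, map_smul, map_one, smul_eq_mul, mul_one, sub_self])
  have h2 := hψ _ h1 h0
  rw [map_sub, map_smul, map_one, smul_eq_mul, mul_one, sub_eq_zero] at h2
  exact Units.ext h2.symm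

namespace IsInflated

variable {c : TwoCocycle k Γ} {S : AddSubgroup Γ} (hc : IsInflated c S)
variable [IsAlgClosed k] [AddMonoid.FG Γ]

/-- A strictly larger `I` yields some `f ∈ Φ(I) ∩ kS` outside `M`. As `f - φ(f)` lies in the core,
the nonzero scalar `φ(f)` lies in `Φ(I)`. -/
theorem isCoatom_twistCore (M : Ideal (AddMonoidAlgebra k Γ)) [hM : M.IsMaximal] :
    IsCoatom (hc.twistCore M) := by
  refine ⟨hc.twist_ne_top (core_ne_top hM.ne_top), fun I hI => ?_⟩
  obtain ⟨φ, hφ⟩ := exists_algHom_ker_eq M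
  obtain ⟨f, hf, hf0, hfM⟩ : ∃ f ∈ hc.untwist I, cosetPart S 0 f = f ∧ f ∉ M := by
    by_contra! hcon
    exact hI.not_ge (hc.le_twistCore_iff.2 ((hc.isHomogeneous_untwist I).le_of_forall hcon))
  have h0 : cosetPart S 0 (φ f • (1 : AddMonoidAlgebra k Γ)) = φ f • 1 := by
    rw [map_smul, AddMonoidAlgebra.one_def, cosetPart_zero_single S.zero_mem]
  have h1 : f - φ f • 1 ∈ hc.untwist I := by
    have : f - φ f • 1 ∈ core (perp k S) M := by
      refine mem_core_of_cosetPart_eq ((hφ _).1 ?_) (by rw [map_sub, hf0, h0])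
      rw [map_sub, map_smul, map_one, smul_eq_mul, mul_one, sub_self]
    exact hI.le (x := (Phi c).symm (f - φ f • 1)) (hc.mem_twistCore.2 this)
  have h2 : φ f • (1 : AddMonoidAlgebra k Γ) ∈ hc.untwist I := by
    simpa using (hc.untwist I).sub_mem hf h1
  have h3 := smul_mem_ideal _ (φ f)⁻¹ h2
  rw [smul_smul, inv_mul_cancel₀ (fun h => hfM ((hφ f).1 h)), one_smul] at h3
  by_contra hcon
  exact hc.untwist_ne_top hcon ((Ideal.eq_top_iff_one _).2 h3)

/-- The map `M ↦ Φ⁻¹(M : S^⊥)` of maximal spectra. -/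
def maxMap (M : MaximalSpectrum (AddMonoidAlgebra k Γ)) : MaxSpec (TwistedGroupAlgebra c) :=
  ⟨hc.twistCore M.asIdeal, have := M.isMaximal; hc.isCoatom_twistCore M.asIdeal⟩

theorem maxMap_smul (h : AddChar Γ kˣ) (M : MaximalSpectrum (AddMonoidAlgebra k Γ)) :
    hc.maxMap (h • M) = h • hc.maxMap M :=
  MaxSpec.ext (hc.twistCore_smul h M.asIdeal)

theorem maxMap_surjective : Function.Surjective hc.maxMap := by
  intro Q
  obtain ⟨M, hM, hle⟩ := Ideal.exists_le_maximal _ (hc.untwist_ne_top Q.isMaximal.1)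
  refine ⟨⟨M, hM⟩, MaxSpec.ext ?_⟩
  exact ((Q.isMaximal.le_iff_eq (hc.isCoatom_twistCore M).1).1 (hc.le_twistCore_iff.2 hle))

/-- A restriction of a quotient map need not be a quotient map, so the argument for primes is
repeated with intersections of maximal ideals. -/
theorem isQuotientMap_maxMap : Topology.IsQuotientMap hc.maxMap := by
  refine Topology.isQuotientMap_iff_isClosed.2 ⟨hc.maxMap_surjective, fun Z => ⟨?_, fun hZ => ?_⟩⟩
  · rw [isClosed_induced_iff, isClosed_induced_iff]
    rintro ⟨Y, hY, rfl⟩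
    exact ⟨hc.specMap ⁻¹' Y, hY.preimage hc.isQuotientMap_specMap.continuous, rfl⟩
  · obtain ⟨Y, hY, hYZ⟩ := isClosed_induced_iff.1 hZ
    obtain ⟨K, rfl⟩ := (PrimeSpectrum.isClosed_iff_zeroLocus_ideal _).1 hY
    have hmem : ∀ M, hc.maxMap M ∈ Z ↔ K ≤ M.asIdeal := fun M =>
      (Set.ext_iff.1 hYZ M).symm
    have hst : IsStable S (sInf {P | ∃ M : MaximalSpectrum (AddMonoidAlgebra k Γ),
        hc.maxMap M ∈ Z ∧ M.asIdeal = P}) := isStable_sInf (by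
      rintro h hh _ ⟨M, hM, rfl⟩
      refine ⟨h • M, ?_, rfl⟩
      rwa [show hc.maxMap (h • M) = hc.maxMap M from
        MaxSpec.ext (hc.twistCore_smul_of_mem hh M.asIdeal)])
    refine isClosed_induced_iff.2 ⟨V (hc.twist _ hst), (isClosed_iff _).2 ⟨_, rfl⟩,
      Set.ext fun Q => ?_⟩
    obtain ⟨M, rfl⟩ := hc.maxMap_surjective Q
    refine ⟨fun h => (hmem M).2 ?_, fun h => ?_⟩
    · refine le_trans (le_sInf ?_) (((hc.twist_le_iff.1 h :)).trans fun f hf =>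
        core_le _ _ (hc.mem_twistCore.1 hf))
      rintro _ ⟨M', hM', rfl⟩
      exact (hmem M').1 hM'
    · exact fun f hf => hc.mem_twistCore.2
        (hst.le_core (sInf_le ⟨M, h, rfl⟩) (hc.mem_twist.1 hf))

theorem maxMap_preimage (M : MaximalSpectrum (AddMonoidAlgebra k Γ)) :
    hc.maxMap ⁻¹' {hc.maxMap M} = MulAction.orbit (perp k S) M := by
  ext M'
  constructor
  · intro h
    have hcore : core (perp k S) M'.asIdeal = core (perp k S) M.asIdeal := by
      ext f
      have := SetLike.ext_iff.1 (congrArg MaxSpec.asIdeal h) ((Phi c).symm f)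
      exact (hc.mem_twistCore.symm.trans this).trans hc.mem_twistCore
    have := M.isMaximal
    have := M'.isMaximal
    obtain ⟨φ, hφ⟩ := exists_algHom_ker_eq M.asIdeal
    obtain ⟨ψ, hψ⟩ := exists_algHom_ker_eq M'.asIdeal
    have hS : ∀ α ∈ S, charOfAlgHom φ α = charOfAlgHom ψ α := fun α hα =>
      charOfAlgHom_eq hα hφ fun f hf hf0 => (hψ f).2 (core_le (perp k S) _
        (hcore ▸ mem_core_of_cosetPart_eq hf hf0))
    -- Both points are characters of all of `Γ` that agree on `S`; their quotient lies in `S^⊥` and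
    -- carries `M` to `M'`.
    let χ : AddChar Γ kˣ := charOfAlgHom φ * (charOfAlgHom ψ)⁻¹
    have hχ : χ ∈ perp k S := fun α hα => by
      rw [AddChar.mul_apply, AddChar.inv_apply, hS α hα, ← AddChar.map_add_eq_mul, add_neg_cancel,
        AddChar.map_zero_eq_one]
    refine ⟨⟨χ, hχ⟩, MaximalSpectrum.ext ?_⟩
    change χ • M.asIdeal = M'.asIdeal
    ext f
    rw [Ideal.mem_pointwise_smul_iff_inv_smul_mem, ← hφ, ← hψ,
      algHom_char_smul (ψ := ψ) fun α => ?_]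
    rw [AddChar.inv_apply, AddChar.mul_apply, AddChar.inv_apply, neg_neg, ← mul_assoc,
      ← AddChar.map_add_eq_mul, add_neg_cancel, AddChar.map_zero_eq_one, one_mul]
  · rintro ⟨⟨h, hh⟩, rfl⟩
    exact MaxSpec.ext (hc.twistCore_smul_of_mem hh M.asIdeal)

end IsInflated

end MaximalSpectra

/-! ### The pairing `σ` and a cocycle trivial on its radical. -/

section Cocycles

variable {k : Type*} [Field k] {n : ℕ} (q : Matrix (Fin n) (Fin n) kˣ)

/-! ### The pairing `σ` -/

theorem sigma_add_right (α β γ : Fin n → ℤ) :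
    sigma q α (β + γ) = sigma q α β * sigma q α γ := by
  simp only [sigma, Pi.add_apply, mul_add, zpow_add, Finset.prod_mul_distrib]

/-- The character `σ(α,·)`. -/
def sigmaChar (α : Fin n → ℤ) : AddChar (Fin n → ℤ) kˣ where
  toFun := sigma q α
  map_zero_eq_one' := by simp [sigma]
  map_add_eq_mul' := sigma_add_right q α

theorem sigmaChar_apply (α β : Fin n → ℤ) : sigmaChar q α β = sigma q α β := rfl

theorem sigma_single_single (i j : Fin n) :
    sigma q (Pi.single i 1) (Pi.single j 1) = q i j := by
  rw [sigma, Finset.prod_eq_single i, Finset.prod_eq_single j]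
  · simp
  · intro j' _ hj'
    simp [hj']
  · simp
  · intro i' _ hi'
    simp [hi']
  · simp

variable {q}

theorem sigma_swap (hq : IsMulAntisymm q) (α β : Fin n → ℤ) :
    sigma q β α = (sigma q α β)⁻¹ := by
  rw [sigma, sigma, Finset.prod_comm, ← Finset.prod_inv_distrib]
  refine Finset.prod_congr rfl fun i _ => ?_
  rw [← Finset.prod_inv_distrib]
  refine Finset.prod_congr rfl fun j _ => ?_
  rw [hq.2 i j, inv_zpow, mul_comm]

/-- The factors at `(i,j)` and `(j,i)` cancel and the diagonal ones are 1. Antisymmetry of `σ` alone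
would give only `σ(α,α)² = 1`. -/
theorem sigma_self (hq : IsMulAntisymm q) (α : Fin n → ℤ) : sigma q α α = 1 := by
  rw [sigma, ← Finset.prod_product']
  refine Finset.prod_involution (fun p _ => p.swap) (fun p _ => ?_) (fun p _ hp h => hp ?_)
    (fun _ _ => Finset.mem_univ _) (fun p _ => p.swap_swap)
  · rw [Prod.fst_swap, Prod.snd_swap, hq.2 p.1 p.2, inv_zpow, mul_comm (α p.2), mul_inv_cancel]
  · have : p.2 = p.1 := congrArg Prod.fst h
    rw [this, hq.1, one_zpow]

theorem sigma_sum_right {ι : Type*} [Fintype ι] (α : Fin n → ℤ) (a : ι → ℤ)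
    (b : ι → Fin n → ℤ) : sigma q α (∑ j, a j • b j) = ∏ j, sigma q α (b j) ^ a j := by
  have h := map_prod (sigmaChar q α).toMonoidHom (fun j => Multiplicative.ofAdd (a j • b j))
    Finset.univ
  rw [← ofAdd_sum] at h
  exact h.trans <| Finset.prod_congr rfl fun j _ => (sigmaChar q α).map_zsmul_eq_zpow (a j) (b j)

theorem sigma_sum_left (hq : IsMulAntisymm q) {ι : Type*} [Fintype ι] (α : Fin n → ℤ) (a : ι → ℤ)
    (b : ι → Fin n → ℤ) : sigma q (∑ j, a j • b j) α = ∏ j, sigma q (b j) α ^ a j := by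
  rw [sigma_swap hq α, sigma_sum_right, ← Finset.prod_inv_distrib]
  exact Finset.prod_congr rfl fun j _ => by rw [sigma_swap hq α, inv_zpow]

/-! ### Existence of the cocycle -/

/-- The bimultiplicative cocycle `∏_{i<j} s_{ij}^{α_i β_j}` in the coordinates of a basis. -/
def upperCocycle {ι Γ : Type*} [Fintype ι] [LinearOrder ι] [AddCommGroup Γ]
    (b : Module.Basis ι ℤ Γ) (s : ι → ι → kˣ) : TwoCocycle k Γ where
  toFun α β := ∏ i, ∏ j, if i < j then s i j ^ (b.repr α i * b.repr β j) else 1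
  cocycle α β γ := by
    simp only [← Finset.prod_mul_distrib]
    refine Finset.prod_congr rfl fun i _ => Finset.prod_congr rfl fun j _ => ?_
    split_ifs
    · simp only [map_add, Finsupp.add_apply, ← zpow_add]
      congr 1
      ring
    · rfl

theorem upperCocycle_apply {ι Γ : Type*} [Fintype ι] [LinearOrder ι] [AddCommGroup Γ]
    (b : Module.Basis ι ℤ Γ) (s : ι → ι → kˣ) (α β : Γ) : upperCocycle b s α β
      = ∏ i, ∏ j, if i < j then s i j ^ (b.repr α i * b.repr β j) else 1 := rfl

/-- In the expansion of `σ` along `b`, the terms `i < j` come from `c(α,β)`, the terms `i > j` from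
`c(β,α)⁻¹`, and the diagonal is trivial. -/
theorem upperCocycle_commutator {ι : Type*} [Fintype ι] [LinearOrder ι] (hq : IsMulAntisymm q)
    (b : Module.Basis ι ℤ (Fin n → ℤ)) (α β : Fin n → ℤ) :
    upperCocycle b (fun i j => sigma q (b i) (b j)) α β
      * (upperCocycle b (fun i j => sigma q (b i) (b j)) β α)⁻¹ = sigma q α β := by
  conv_rhs => rw [← b.sum_repr α, ← b.sum_repr β, sigma_sum_left hq]
  rw [upperCocycle_apply, upperCocycle_apply, Finset.prod_comm (f := fun i j => if i < j then
    sigma q (b i) (b j) ^ (b.repr β i * b.repr α j) else 1), ← Finset.prod_inv_distrib,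
    ← Finset.prod_mul_distrib]
  refine Finset.prod_congr rfl fun i _ => ?_
  rw [sigma_sum_right, ← Finset.prod_zpow, ← Finset.prod_inv_distrib, ← Finset.prod_mul_distrib]
  refine Finset.prod_congr rfl fun j _ => ?_
  rw [← zpow_mul]
  rcases lt_trichotomy i j with h | rfl | h
  · rw [if_pos h, if_neg h.not_gt, inv_one, mul_one, mul_comm]
  · rw [if_neg (lt_irrefl _), if_neg (lt_irrefl _), inv_one, mul_one, sigma_self hq, one_zpow]
  · rw [if_neg h.not_gt, if_pos h, one_mul, sigma_swap hq (b i), inv_zpow, inv_inv]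

/-- The triangular cocycle in the standard basis need not be trivial on the radical, hence the
adapted basis. -/
theorem exists_cocycle (hq : IsMulAntisymm q) : ∃ c : TwoCocycle k (Fin n → ℤ),
    (∀ α β, c α β * (c β α)⁻¹ = sigma q α β) ∧ ∀ α ∈ rad q, ∀ β, c α β = 1 := by
  obtain ⟨m, snf⟩ := Submodule.smithNormalForm (Pi.basisFun ℤ (Fin n))
    (AddSubgroup.toIntSubmodule (rad q))
  refine ⟨upperCocycle snf.bM fun i j => sigma q (snf.bM i) (snf.bM j),
    upperCocycle_commutator hq snf.bM, fun α hα β => ?_⟩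
  -- The radical is spanned by multiples of some of the basis vectors, so it contains each basis
  -- component of `α`.
  have key : ∀ i, snf.bM.repr α i • snf.bM i ∈ rad q := by
    intro i
    by_cases hi : i ∈ Set.range snf.f
    · obtain ⟨j, rfl⟩ := hi
      have h1 := snf.repr_apply_embedding_eq_repr_smul (m := ⟨α, hα⟩) (i := j)
      have h2 := (snf.bN.repr ⟨α, hα⟩ j • snf.bN j).2
      rw [Submodule.coe_smul, snf.snf, smul_smul] at h2
      have h3 : snf.bM.repr α (snf.f j) = snf.bN.repr ⟨α, hα⟩ j * snf.a j := by
        rw [h1, map_smul, Finsupp.smul_apply, smul_eq_mul, mul_comm]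
      rw [h3]
      exact h2
    · rw [snf.repr_eq_zero_of_notMem_range ⟨α, hα⟩ hi, zero_smul]
      exact zero_mem _
  rw [upperCocycle_apply]
  refine Finset.prod_eq_one fun i _ => Finset.prod_eq_one fun j _ => ?_
  split_ifs
  -- The factor is `σ(α_i b_i, b_j)` raised to the `j`-th coordinate of `β`.
  · rw [zpow_mul, sigma_swap hq (snf.bM j), inv_zpow, ← sigmaChar_apply,
      ← AddChar.map_zsmul_eq_zpow, sigmaChar_apply, ← sigma_swap hq, key i, one_zpow]
  · rfl

theorem isInflated_of_sigma (hq : IsMulAntisymm q) {c : TwoCocycle k (Fin n → ℤ)}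
    (hσ : ∀ α β, c α β * (c β α)⁻¹ = sigma q α β) (h1 : ∀ α ∈ rad q, ∀ β, c α β = 1) :
    IsInflated c (rad q) where
  one_left := h1
  one_right α hα β := by
    have := hσ α β
    rwa [h1 α hα, hα β, one_mul, inv_eq_one] at this
  exists_char β := ⟨sigmaChar q β, fun α hα => by
    rw [sigmaChar_apply, sigma_swap hq, hα β, inv_one], fun α => by
    rw [sigmaChar_apply, ← hσ, inv_mul_cancel_right]⟩
  exists_ne α hα := by
    by_contra! hcon
    exact hα fun β => by rw [← hσ, hcon β, mul_inv_cancel]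

end Cocycles

/-! ### The isomorphism of `A` with the quantum torus. -/

section QuantumTorus

/-! ### Units modulo scalars -/

/-- The group of invertible scalars in a `k`-algebra. -/
def scalarUnits (k O : Type*) [Field k] [Ring O] [Algebra k O] : Subgroup Oˣ :=
  (Units.map (algebraMap k O).toMonoidHom).range

instance (k O : Type*) [Field k] [Ring O] [Algebra k O] : (scalarUnits k O).Normal where
  conj_mem := by
    rintro _ ⟨s, rfl⟩ u
    refine ⟨s, Units.ext ?_⟩
    change algebraMap k O s = u * algebraMap k O s * (u⁻¹ : Oˣ)
    rw [← Algebra.commutes, mul_assoc, Units.mul_inv, mul_one]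

variable {k : Type*} [Field k]

theorem mk_eq_mk_iff {O : Type*} [Ring O] [Algebra k O] {u v : Oˣ} :
    (QuotientGroup.mk u : Oˣ ⧸ scalarUnits k O) = QuotientGroup.mk v
      ↔ ∃ s : kˣ, (v : O) = (s : k) • (u : O) := by
  rw [QuotientGroup.eq]
  constructor
  · rintro ⟨s, hs⟩
    refine ⟨s, ?_⟩
    rw [Algebra.smul_def, Algebra.commutes]
    change (v : O) = (u * Units.map (algebraMap k O).toMonoidHom s : Oˣ)
    rw [hs, mul_inv_cancel_left]
  · rintro ⟨s, hs⟩
    refine ⟨s, eq_inv_mul_of_mul_eq (Units.ext ?_)⟩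
    rw [hs, Algebra.smul_def, Algebra.commutes]
    rfl

/-- If `v = s u`, then `φ(u) = s φ(u)` with `φ(u)` a unit of a nonzero algebra, so `s = 1`. This
removes the scalar ambiguity of monomials. -/
theorem eq_of_mk_eq_of_map_eq {O A : Type*} [Ring O] [Algebra k O] [Ring A] [Algebra k A]
    [Nontrivial A] (φ : O →ₐ[k] A) {u v : Oˣ}
    (h : (QuotientGroup.mk u : Oˣ ⧸ scalarUnits k O) = QuotientGroup.mk v)
    (h' : φ u = φ v) : u = v := by
  obtain ⟨s, hs⟩ := mk_eq_mk_iff.1 h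
  have h1 : (φ u : A) = (s : k) • φ u := by rw [← map_smul, ← hs, h']
  have h2 : (s : k) • (1 : A) = 1 := by
    have := congrArg (· * φ (u⁻¹ : Oˣ)) h1
    simp only [smul_mul_assoc, ← map_mul, Units.mul_inv, map_one] at this
    exact this.symm
  have h3 : (s : k) = 1 := by
    apply (algebraMap k A).injective
    rw [Algebra.algebraMap_eq_smul_one, h2, map_one]
  exact Units.ext (by rw [hs, h3, one_smul])

/-- A unit scaled by an invertible scalar. -/
def scaleUnit {O : Type*} [Ring O] [Algebra k O] (s : kˣ) (u : Oˣ) : Oˣ :=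
  Units.map (algebraMap k O).toMonoidHom s * u

theorem coe_scaleUnit {O : Type*} [Ring O] [Algebra k O] (s : kˣ) (u : Oˣ) :
    (scaleUnit s u : O) = (s : k) • (u : O) :=
  (Algebra.smul_def _ _).symm

theorem mk_scaleUnit {O : Type*} [Ring O] [Algebra k O] (s : kˣ) (u : Oˣ) :
    (QuotientGroup.mk (scaleUnit s u) : Oˣ ⧸ scalarUnits k O) = QuotientGroup.mk u :=
  (mk_eq_mk_iff.2 ⟨s, coe_scaleUnit s u⟩).symm

/-! ### The homomorphism from the quantum torus -/

variable {n : ℕ}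

namespace TwistedGroupAlgebra

variable {Γ : Type*} [AddCommGroup Γ]

instance (c : TwoCocycle k Γ) : Nontrivial (TwistedGroupAlgebra c) :=
  inferInstanceAs (Nontrivial (Γ →₀ k))

theorem x_zero {c : TwoCocycle k Γ} (h0 : c 0 0 = 1) : x c 0 = 1 := by
  change mono c 0 1 = mono c 0 _
  rw [h0, inv_one, Units.val_one]

/-- `x_α` as a unit. -/
def xUnit {c : TwoCocycle k Γ} (h0 : c 0 0 = 1) (α : Γ) : (TwistedGroupAlgebra c)ˣ where
  val := x c α
  inv := (((c α (-α))⁻¹ : kˣ) : k) • x c (-α)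
  val_inv := by
    rw [mul_smul_comm, x_mul_x, smul_smul, Units.inv_mul, one_smul, add_neg_cancel, x_zero h0]
  inv_val := by
    have : c α (-α) = c (-α) α := by
      have := c.cocycle α (-α) α
      rwa [add_neg_cancel, neg_add_cancel, cocycle_zero_left, cocycle_zero_right c α, h0, mul_one,
        mul_one] at this
    rw [smul_mul_assoc, x_mul_x, smul_smul, this, Units.inv_mul, one_smul, neg_add_cancel,
      x_zero h0]

end TwistedGroupAlgebra

namespace QuantumTorus

variable (q : Matrix (Fin n) (Fin n) kˣ)

/-- The inverse of the generator `x_i`. -/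
def Xinv (i : Fin n) : QuantumTorus q :=
  RingQuot.mkAlgHom k (QuantumTorusRel q) (FreeAlgebra.ι k (Sum.inr i))

/-- The generator `x_i` as a unit. -/
def XUnit (i : Fin n) : (QuantumTorus q)ˣ where
  val := X q i
  inv := Xinv q i
  val_inv := by
    rw [X, Xinv, ← map_mul, RingQuot.mkAlgHom_rel k (QuantumTorusRel.mul_inv i), map_one]
  inv_val := by
    rw [X, Xinv, ← map_mul, RingQuot.mkAlgHom_rel k (QuantumTorusRel.inv_mul i), map_one]

theorem X_mul_X (i j : Fin n) : X q i * X q j = (q i j : k) • (X q j * X q i) := by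
  rw [X, X, ← map_mul, RingQuot.mkAlgHom_rel k (QuantumTorusRel.comm i j), map_smul, map_mul]

/-- The class of the ordered monomial `x_1^{α_1} ⋯ x_n^{α_n}` modulo scalars. -/
def monomialClass : (Fin n → Multiplicative ℤ) →*
    (QuantumTorus q)ˣ ⧸ scalarUnits k (QuantumTorus q) :=
  MonoidHom.noncommPiCoprod (fun i => zpowersHom _ (QuotientGroup.mk (XUnit q i))) (by
    intro i j _ a b
    rw [zpowersHom_apply, zpowersHom_apply]
    refine Commute.zpow_zpow ?_ _ _
    change QuotientGroup.mk (XUnit q i * XUnit q j) = QuotientGroup.mk (XUnit q j * XUnit q i)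
    exact (mk_eq_mk_iff.2 ⟨q i j, X_mul_X q i j⟩).symm)

theorem monomialClass_single (i : Fin n) :
    monomialClass q (fun j => Multiplicative.ofAdd ((Pi.single i 1 : Fin n → ℤ) j))
      = QuotientGroup.mk (XUnit q i) := by
  have : (fun j => Multiplicative.ofAdd ((Pi.single i 1 : Fin n → ℤ) j))
      = Pi.mulSingle i (Multiplicative.ofAdd 1) := by
    ext j
    by_cases h : j = i
    · subst h
      simp
    · simp [h]
  rw [this]
  exact (MonoidHom.noncommPiCoprod_mulSingle _ i _).trans
    ((zpowersHom_apply _ _ _).trans (zpow_one _))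

variable {q} {c : TwoCocycle k (Fin n → ℤ)} (h0 : c 0 0 = 1)
  (hσ : ∀ α β, c α β * (c β α)⁻¹ = sigma q α β)

/-- The algebra homomorphism from the quantum torus to the twisted group algebra with
`x_i ↦ x_{ε_i}`. -/
def toTwisted : QuantumTorus q →ₐ[k] TwistedGroupAlgebra c :=
  RingQuot.liftAlgHom k ⟨FreeAlgebra.lift k (Sum.elim
    (fun i => (TwistedGroupAlgebra.xUnit h0 (Pi.single i 1)).val)
    (fun i => (TwistedGroupAlgebra.xUnit h0 (Pi.single i 1)).inv)), by
    rintro _ _ (i | i | ⟨i, j⟩)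
    · simp only [map_mul, map_one, FreeAlgebra.lift_ι_apply, Sum.elim_inl, Sum.elim_inr,
        Units.val_inv]
    · simp only [map_mul, map_one, FreeAlgebra.lift_ι_apply, Sum.elim_inl, Sum.elim_inr,
        Units.inv_val]
    · simp only [map_mul, map_smul, FreeAlgebra.lift_ι_apply, Sum.elim_inl]
      change TwistedGroupAlgebra.x c _ * TwistedGroupAlgebra.x c _
        = _ • (TwistedGroupAlgebra.x c _ * TwistedGroupAlgebra.x c _)
      rw [TwistedGroupAlgebra.x_mul_x, TwistedGroupAlgebra.x_mul_x, smul_smul, ← Units.val_mul,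
        ← sigma_single_single q, ← hσ, inv_mul_cancel_right, add_comm]⟩

theorem toTwisted_X (i : Fin n) :
    toTwisted h0 hσ (X q i) = TwistedGroupAlgebra.x c (Pi.single i 1) := by
  rw [toTwisted, X, RingQuot.liftAlgHom_mkAlgHom_apply, FreeAlgebra.lift_ι_apply, Sum.elim_inl]
  rfl

/-- Units of the quantum torus in the class of a monomial, which map to basis elements. -/
theorem exists_monomial (α : Fin n → ℤ) : ∃ u : (QuantumTorus q)ˣ,
    QuotientGroup.mk u = monomialClass q (fun i => Multiplicative.ofAdd (α i)) ∧
      toTwisted h0 hσ u = TwistedGroupAlgebra.x c α := by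
  -- The exponents admitting such a unit form a subgroup, after rescaling lifts by values of `c`,
  -- and it contains the standard basis.
  let T : AddSubgroup (Fin n → ℤ) :=
    { carrier := {α | ∃ u : (QuantumTorus q)ˣ,
        QuotientGroup.mk u = monomialClass q (fun i => Multiplicative.ofAdd (α i)) ∧
          toTwisted h0 hσ u = TwistedGroupAlgebra.x c α}
      zero_mem' := ⟨1, (map_one (monomialClass q)).symm, by
        rw [Units.val_one, map_one, TwistedGroupAlgebra.x_zero h0]⟩
      add_mem' := by
        rintro α β ⟨u, hu, hu'⟩ ⟨v, hv, hv'⟩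
        refine ⟨scaleUnit (c α β)⁻¹ (u * v), ?_, ?_⟩
        · rw [mk_scaleUnit, QuotientGroup.mk_mul, hu, hv, ← map_mul]
          rfl
        · rw [coe_scaleUnit, map_smul, Units.val_mul, map_mul, hu', hv',
            TwistedGroupAlgebra.x_mul_x, smul_smul, Units.inv_mul, one_smul]
      neg_mem' := by
        rintro α ⟨u, hu, hu'⟩
        refine ⟨scaleUnit (c α (-α)) u⁻¹, ?_, ?_⟩
        · rw [mk_scaleUnit, QuotientGroup.mk_inv, hu, ← map_inv]
          rfl
        · have h1 : Units.map (toTwisted h0 hσ).toRingHom.toMonoidHom u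
              = TwistedGroupAlgebra.xUnit h0 α := Units.ext hu'
          have h2 : toTwisted h0 hσ (u⁻¹ : (QuantumTorus q)ˣ)
              = (((c α (-α))⁻¹ : kˣ) : k) • TwistedGroupAlgebra.x c (-α) :=
            congrArg Units.val (congrArg (·⁻¹) h1)
          rw [coe_scaleUnit, map_smul, h2, smul_smul, Units.mul_inv, one_smul] }
  have hT : ∀ i, Pi.single i 1 ∈ T := fun i =>
    ⟨XUnit q i, (monomialClass_single q i).symm, toTwisted_X h0 hσ i⟩
  have : α = ∑ i, α i • (Pi.single i 1 : Fin n → ℤ) := by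
    ext j
    simp [Finset.sum_apply, Pi.single_apply]
  change α ∈ T
  rw [this]
  exact sum_mem fun i _ => zsmul_mem (hT i) _

/-- The unit of the quantum torus corresponding to `x_α`. -/
def monomial (α : Fin n → ℤ) : (QuantumTorus q)ˣ := (exists_monomial h0 hσ α).choose

theorem mk_monomial (α : Fin n → ℤ) : QuotientGroup.mk (monomial h0 hσ α)
    = monomialClass q (fun i => Multiplicative.ofAdd (α i)) :=
  (exists_monomial h0 hσ α).choose_spec.1

theorem toTwisted_monomial (α : Fin n → ℤ) :
    toTwisted h0 hσ (monomial h0 hσ α) = TwistedGroupAlgebra.x c α :=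
  (exists_monomial h0 hσ α).choose_spec.2

theorem monomial_zero : monomial h0 hσ 0 = 1 := by
  refine eq_of_mk_eq_of_map_eq (toTwisted h0 hσ) ?_ ?_
  · rw [mk_monomial]
    exact map_one (monomialClass q)
  · rw [toTwisted_monomial, Units.val_one, map_one, TwistedGroupAlgebra.x_zero h0]

theorem monomial_single (i : Fin n) : monomial h0 hσ (Pi.single i 1) = XUnit q i := by
  refine eq_of_mk_eq_of_map_eq (toTwisted h0 hσ) ?_ ?_
  · rw [mk_monomial, monomialClass_single]
  · rw [toTwisted_monomial]
    exact (toTwisted_X h0 hσ i).symm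

/-- Both sides have the same class modulo scalars and the same image `x_α x_β` in `A`. -/
theorem monomial_mul (α β : Fin n → ℤ) : (monomial h0 hσ α * monomial h0 hσ β : QuantumTorus q)
    = ((c α β : kˣ) : k) • (monomial h0 hσ (α + β) : QuantumTorus q) := by
  rw [← coe_scaleUnit, ← Units.val_mul, Units.val_inj]
  refine eq_of_mk_eq_of_map_eq (toTwisted h0 hσ) ?_ ?_
  · rw [mk_scaleUnit, QuotientGroup.mk_mul, mk_monomial, mk_monomial, mk_monomial, ← map_mul]
    rfl
  · rw [coe_scaleUnit, map_smul, Units.val_mul, map_mul, toTwisted_monomial, toTwisted_monomial,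
      toTwisted_monomial, TwistedGroupAlgebra.x_mul_x]

/-- The linear map with `x_α` going to the corresponding monomial. -/
def ofTwistedLinear : TwistedGroupAlgebra c →ₗ[k] QuantumTorus q :=
  Finsupp.linearCombination k fun α => (monomial h0 hσ α : QuantumTorus q)

theorem ofTwistedLinear_mono (α : Fin n → ℤ) (a : k) :
    ofTwistedLinear h0 hσ (TwistedGroupAlgebra.mono c α a)
      = a • (monomial h0 hσ α : QuantumTorus q) :=
  Finsupp.linearCombination_single k a α

/-- The algebra homomorphism inverse to `toTwisted`. -/
def ofTwisted : TwistedGroupAlgebra c →ₐ[k] QuantumTorus q :=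
  AlgHom.ofLinearMap (ofTwistedLinear h0 hσ)
    (by rw [← TwistedGroupAlgebra.x_zero h0, TwistedGroupAlgebra.x, ofTwistedLinear_mono, one_smul,
      monomial_zero, Units.val_one])
    (fun f g => by
      refine TwistedGroupAlgebra.induction (p := fun f => ofTwistedLinear h0 hσ (f * g)
        = ofTwistedLinear h0 hσ f * ofTwistedLinear h0 hσ g) f (by simp)
        (fun _ _ h1 h2 => by simp only [add_mul, map_add, h1, h2]) fun α a => ?_
      refine TwistedGroupAlgebra.induction (p := fun g => ofTwistedLinear h0 hσ (_ * g)
        = ofTwistedLinear h0 hσ _ * ofTwistedLinear h0 hσ g) g (by simp)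
        (fun _ _ h1 h2 => by simp only [mul_add, map_add, h1, h2]) fun β b => ?_
      simp only [TwistedGroupAlgebra.mono_mul_mono, ofTwistedLinear_mono, smul_mul_smul_comm,
        monomial_mul, smul_smul])

theorem ofTwisted_x (α : Fin n → ℤ) :
    ofTwisted h0 hσ (TwistedGroupAlgebra.x c α) = monomial h0 hσ α :=
  (ofTwistedLinear_mono h0 hσ α 1).trans (one_smul _ _)

theorem toTwisted_ofTwisted (f : TwistedGroupAlgebra c) :
    toTwisted h0 hσ (ofTwisted h0 hσ f) = f := by
  refine TwistedGroupAlgebra.induction (p := fun f => toTwisted h0 hσ (ofTwisted h0 hσ f) = f) f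
    (by rw [map_zero, map_zero]) (fun _ _ h1 h2 => by rw [map_add, map_add, h1, h2]) fun α a => ?_
  have : TwistedGroupAlgebra.mono c α a = a • TwistedGroupAlgebra.x c α := by
    rw [TwistedGroupAlgebra.x, TwistedGroupAlgebra.smul_mono, mul_one]
  rw [this, map_smul, map_smul, ofTwisted_x, toTwisted_monomial]

theorem ofTwisted_comp_toTwisted :
    (ofTwisted h0 hσ).comp (toTwisted h0 hσ) = AlgHom.id k (QuantumTorus q) := by
  have hX : ∀ i, ofTwisted h0 hσ (toTwisted h0 hσ (X q i)) = X q i := fun i => by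
    rw [toTwisted_X, ofTwisted_x, monomial_single]
    rfl
  refine RingQuot.ringQuot_ext' _ _ _ (FreeAlgebra.hom_ext (funext ?_))
  rintro (i | i)
  · exact hX i
  -- The generator `x_i⁻¹` is fixed because the unit `x_i` is.
  · have h1 : Units.map ((ofTwisted h0 hσ).comp (toTwisted h0 hσ)).toRingHom.toMonoidHom (XUnit q i)
        = XUnit q i := Units.ext (hX i)
    exact congrArg Units.val (congrArg (·⁻¹) h1)

end QuantumTorus

end QuantumTorus

end QTorus

end

theorem theorem3p11 {k : Type*} [Field k] [IsAlgClosed k] {n : ℕ}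
    (q : Matrix (Fin n) (Fin n) kˣ) (hq : QTorus.IsMulAntisymm q) :
    -- for every `q` there is a suitable cocycle
    (∃ c : QTorus.TwoCocycle k (Fin n → ℤ),
      (∀ α β, c α β * (c β α)⁻¹ = QTorus.sigma q α β) ∧
      (∀ α ∈ QTorus.rad q, ∀ β, c α β = 1)) ∧
    ∀ c : QTorus.TwoCocycle k (Fin n → ℤ),
      (∀ α β, c α β * (c β α)⁻¹ = QTorus.sigma q α β) →
      (∀ α ∈ QTorus.rad q, ∀ β, c α β = 1) →
      -- the twisted group algebra is the quantum torus
      (∃ θ : QTorus.TwistedGroupAlgebra c ≃ₐ[k] QTorus.QuantumTorus q,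
        ∀ i, θ (QTorus.TwistedGroupAlgebra.x c (Pi.single i 1)) = QTorus.QuantumTorus.X q i) ∧
      -- the map on prime spectra
      (∃ π : PrimeSpectrum (AddMonoidAlgebra k (Fin n → ℤ)) →
          QTorus.Spec (QTorus.TwistedGroupAlgebra c),
        (∀ P, ((π P).asIdeal : Set (QTorus.TwistedGroupAlgebra c)) =
          QTorus.Phi c ⁻¹' (QTorus.core (QTorus.perp k (QTorus.rad q)) P.asIdeal)) ∧
        Topology.IsQuotientMap π ∧
        (∀ (h : AddChar (Fin n → ℤ) kˣ) P, π (h • P) = h • π P)) ∧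
      -- the map on maximal spectra and its fibres
      (∃ μ : MaximalSpectrum (AddMonoidAlgebra k (Fin n → ℤ)) →
          QTorus.MaxSpec (QTorus.TwistedGroupAlgebra c),
        (∀ M, ((μ M).asIdeal : Set (QTorus.TwistedGroupAlgebra c)) =
          QTorus.Phi c ⁻¹' (QTorus.core (QTorus.perp k (QTorus.rad q)) M.asIdeal)) ∧
        Topology.IsQuotientMap μ ∧
        (∀ (h : AddChar (Fin n → ℤ) kˣ) M, μ (h • M) = h • μ M) ∧
        (∀ M, μ ⁻¹' {μ M} = MulAction.orbit (QTorus.perp k (QTorus.rad q)) M)) := by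
  refine ⟨QTorus.exists_cocycle hq, fun c hσ h1 => ?_⟩
  have hc := QTorus.isInflated_of_sigma hq hσ h1
  have h0 : c 0 0 = 1 := h1 0 (zero_mem _) 0
  have : AddMonoid.FG (Fin n → ℤ) :=
    AddGroup.fg_iff_addMonoid_fg.1 (Module.Finite.iff_addGroup_fg.1 inferInstance)
  refine ⟨⟨AlgEquiv.ofAlgHom (QTorus.QuantumTorus.ofTwisted h0 hσ)
      (QTorus.QuantumTorus.toTwisted h0 hσ) (QTorus.QuantumTorus.ofTwisted_comp_toTwisted h0 hσ)
      (AlgHom.ext (QTorus.QuantumTorus.toTwisted_ofTwisted h0 hσ)), fun i => ?_⟩,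
    ⟨hc.specMap, fun P => hc.coe_twist _ (QTorus.isStable_core _ P.asIdeal),
      hc.isQuotientMap_specMap, hc.specMap_smul⟩,
    ⟨hc.maxMap, fun M => hc.coe_twist _ (QTorus.isStable_core _ M.asIdeal),
      hc.isQuotientMap_maxMap, hc.maxMap_smul,
      hc.maxMap_preimage⟩⟩
  exact (QTorus.QuantumTorus.ofTwisted_x h0 hσ _).trans
    (congrArg Units.val (QTorus.QuantumTorus.monomial_single h0 hσ i))
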